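/- **Setting.** Let $U(\theta)=W_L(\theta)\cdots W_1(\theta)$ be a parameterized circuit on $d$ qubits with $L$ layers $W_a(\theta)=V_a\bigotimes_{p=1}^d e^{-i\theta_{(a,p)}\sigma_p^a/2}$, where the $V_a$ are fixed unitaries and the $\sigma^a_p$ are Pauli matrices; $\theta\in\mathbb R^c$ with $c=dL$. Data $(|\phi_x\rangle,y)$ are i.i.d. with $(x,y)\sim Q_{XY}$ on a finite set $\mathcal X\times\mathcal Y$, $\{\Lambda_{\hat y}\}$ is a POVM, $\ell:\mathcal Y\times\mathcal Y\to[0,\infty)$, and the loss is $\mathcal L(\theta)=\mathbb E_{(x,y)\sim Q_{XY}}\sum_{\hat y}\ell(y,\hat y)\langle\phi_x|U(\theta)^\dagger\Lambda_{\hat y}U(\theta)|\phi_x\rangle$, with global minimizer $\theta^\star$. With $d_E(\theta,\theta')^2=2-2\big|\sum_x Q_X(x)\langle\phi_x|U(\theta)^\dagger U(\theta')|\phi_x\rangle\big|$, the ensemble quantum Fisher information metric is $\mathcal F(\theta)_{ij}=\frac12\,\partial_{\delta_i}\partial_{\delta_j}\,d_E(\theta,\theta+\delta)^2\big|_{\delta=0}$.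 **Algorithm (2-QNSCD)** with regularization constant $\beta>0$ and learning rate $\eta$. From $\theta^t$, choose uniformly a pair of distinct coordinates $i=(a,p)$, $j=(b,q)$, named so that $a\le b$, and use six fresh independent samples, all with the circuit at $\theta^t$. (i) On each of two samples, apply the layers before $b$ and measure $\sigma^b_q$ on qubit $q$: outcomes $v_1,v_2\in\{\pm1\}$. (ii) On each of two samples, apply the layers before $a$, measure $\sigma^a_p$ on qubit $p$ (outcome $u_k$), apply the layers $a,\dots,b-1$ to the post-measurement state, and measure $\sigma_q^b$ on qubit $q$ (outcome $w_k$), $k=1,2$. Put $$\tilde Z_{[i,j]}=\begin{pmatrix}\frac{1-u_1u_2}{4(c-1)}+\beta& z\\ z&\frac{1-v_1v_2}{4(c-1)}+\beta\end{pmatrix},\quad z=\tfrac{u_1w_1+u_2w_2}{8}-\tfrac14\cdot\tfrac{u_1+u_2}{2}\cdot\tfrac{v_1+v_2}{2},$$ let $\tilde Z$ be the $c\times c$ matrix with this block in the rows and columns $i,j$ and zeros elsewhere, and $\bar Z=\frac{c(c-1)}2\big(\tilde Z-\frac{2\beta}c\mathbb I\big)$. (iii) For each of the two coordinates, on one sample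 $(|\phi_x\rangle,y)$ each: for $i=(a,p)$, apply the layers before $a$, add an ancilla qubit in the state $|+\rangle$, apply $e^{i\pi\Sigma/4}\otimes|0\rangle\langle0|+e^{-i\pi\Sigma/4}\otimes|1\rangle\langle1|$ with $\Sigma=\sigma^a_p$ acting on qubit $p$, apply the layers $a,\dots,L$, measure $\{\Lambda_{\hat y}\otimes|\mathtt b\rangle\langle \mathtt b|\}$, and put $g_i=(-1)^{1+\mathtt b}\,\ell(y,\hat y)$; likewise for $j$. Put $\mathbf g=\frac c2(g_ie_i+g_je_j)$. The update is $\theta^{t+1}=\theta^t-\eta\,|\bar Z|^{-1}\mathbf g$, where $|Z|=(Z^{T}Z)^{1/2}$. **Theorem.** Let $c>2$, $\mathsf L_2,\beta,\bar\mu>0$, $\eta=\beta/\mathsf L_2$, let $\theta^0\in\mathbb R^c$, and let $S\subseteq\mathbb R^c$ be a set that contains all iterates $\theta^t$, $t\ge0$, almost surely (for instance $S=\mathbb R^c$). Assume: 1. (pairwise $\mathsf L_2$-smoothness) for all coordinates $i,j$, all $\theta\in\mathbb R^c$ and all $h=\alpha_ie_i+\alpha_je_j$ with $\alpha_i,\alpha_j\in\mathbb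 R$: $\mathcal L(\theta+h)\le\mathcal L(\theta)+\nabla\mathcal L(\theta)^{T}h+\frac{\mathsf L_2}2\|h\|^2$; 2. (regularized QGI inequality) for all $\theta\in S$: $\frac12\nabla\mathcal L(\theta)^{T}\big(\frac1{c-1}\mathcal F(\theta)+2\beta\mathbb I\big)^{-1}\nabla\mathcal L(\theta)\ge\bar\mu\,(\mathcal L(\theta)-\mathcal L(\theta^\star))$; 3. (choice of $\beta$) for all $\theta\in S$ and all pairs $(i,j)$, the matrix $\tilde Z_{[i,j]}-\frac{2\beta}c\mathbb I_2$ computed at $\theta$ is positive definite with probability one. Let $$\alpha^2=\sup_{\theta\in S}\max_{(i,j)}\ \mathbb E_\theta\Big[\big\||\tilde Z_{[i,j]}-\tfrac{2\beta}c\mathbb I_2|^{-1}\big\|^2\Big]\ \mathbb E_\theta\big[\|[g_i,g_j]\|^2\big],$$ where $\mathbb E_\theta$ is the expectation over the samples and measurement outcomes when the circuit parameter is $\theta$, and the norms are the spectral and the Euclidean norm. Then $\alpha^2<\infty$, for every $t\ge0$ $$\mathbb E[\mathcal L(\theta^t)-\mathcal L(\theta^\star)]\le\Big(1-\frac{4\bar\mu\beta}{c^2\mathsf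 L_2}\Big)^t(\mathcal L(\theta^0)-\mathcal L(\theta^\star))+\frac{\alpha^2\beta}{4\bar\mu},$$ and consequently $\limsup_{t\to\infty}\mathbb E[\mathcal L(\theta^t)-\mathcal L(\theta^\star)]\le\frac{\alpha^2\beta}{4\bar\mu}$. -/

import Mathlib

noncomputable section

namespace QNSCD

open Matrix
open scoped ComplexOrder MatrixOrder Kronecker

/-! ### Expectations -/

/-- The expectation of `f` under the discrete law `p`.  Every law used below has finite support
(see `iterLaw_support_finite`), so the sum is a finite one. -/
def expect {α : Type*} (p : PMF α) (f : α → ℝ) : ℝ := ∑' a, (p a).toReal * f a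

/-! ### Pure states, unitaries, measurements, Born's rule -/

/-- A pure state: a unit vector of `ℂⁿ`. -/
structure PureState (n : Type*) [Fintype n] where
  vec : n → ℂ
  norm_one : star vec ⬝ᵥ vec = 1

/-- A measurement (POVM) on `ℂⁿ` with outcomes in `O`. -/
structure POVM (O n : Type*) [Fintype O] [Fintype n] [DecidableEq n] where
  op : O → Matrix n n ℂ
  psd : ∀ o, (op o).PosSemidef
  sum_op : ∑ o, op o = 1

section Born

variable {n O : Type*} [Fintype n] [DecidableEq n] [Fintype O]

/-- The state `U ψ`. -/
def PureState.evolve (U : unitaryGroup n ℂ) (ψ : PureState n) : PureState n where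
  vec := (U : Matrix n n ℂ) *ᵥ ψ.vec
  norm_one := by
    have h : (U : Matrix n n ℂ)ᴴ * (U : Matrix n n ℂ) = 1 := by
      have := (mem_unitaryGroup_iff').1 U.2
      rwa [star_eq_conjTranspose] at this
    rw [star_mulVec, dotProduct_mulVec, vecMul_vecMul, h, vecMul_one]
    exact ψ.norm_one

/-- Born's rule: outcome `o` has probability `⟨ψ| E_o |ψ⟩`. -/
def born (E : POVM O n) (ψ : PureState n) : PMF O :=
  PMF.ofFintype (fun o => ENNReal.ofReal (star ψ.vec ⬝ᵥ (E.op o *ᵥ ψ.vec)).re) (by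
    rw [← ENNReal.ofReal_sum_of_nonneg]
    · rw [← Complex.re_sum, ← dotProduct_sum, ← Matrix.sum_mulVec, E.sum_op, one_mulVec,
        ψ.norm_one]
      simp
    · intro o _
      exact (Complex.le_def.1 ((E.psd o).dotProduct_mulVec_nonneg ψ.vec)).1)

/-- The POVM `(K_o† K_o)_o`: outcome `o` occurs on `ψ` with probability `‖K_o ψ‖²`. -/
def POVM.ofKraus (K : O → Matrix n n ℂ) (h : ∑ o, (K o)ᴴ * K o = 1) : POVM O n where
  op o := (K o)ᴴ * K o
  psd o := posSemidef_conjTranspose_mul_self (K o)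
  sum_op := h

/-- The state `ψ ⊗ |+⟩`, where `|+⟩ = (|0⟩ + |1⟩)/√2` is the state of an ancilla qubit. -/
def PureState.withPlus (ψ : PureState n) : PureState (n × Fin 2) where
  vec x := ψ.vec x.1 * (1 / (Real.sqrt 2 : ℝ) : ℂ)
  norm_one := by
    have h := ψ.norm_one
    have h2 : ((Real.sqrt 2 : ℝ) : ℂ) * ((Real.sqrt 2 : ℝ) : ℂ) = 2 := by
      rw [← Complex.ofReal_mul, Real.mul_self_sqrt (by norm_num)]; norm_num
    have h0 : ((Real.sqrt 2 : ℝ) : ℂ) ≠ 0 := by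
      intro h; rw [h] at h2; norm_num at h2
    simp only [dotProduct, Pi.star_apply, Fintype.sum_prod_type] at h ⊢
    refine Eq.trans (Finset.sum_congr rfl fun x _ => ?_) h
    simp only [Fin.sum_univ_two, star_mul', RCLike.star_def, map_div₀, map_one, Complex.conj_ofReal]
    field_simp
    rw [sq, h2]
    ring

/-- The measurement `{Λ_o ⊗ |b⟩⟨b|}` of a system together with an ancilla qubit. -/
def POVM.withAncilla (Λ : POVM O n) : POVM (O × Fin 2) (n × Fin 2) where
  op o := Λ.op o.1 ⊗ₖ Matrix.single o.2 o.2 (1 : ℂ)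
  psd o := by
    refine (Λ.psd o.1).kronecker ?_
    have : (Matrix.single o.2 o.2 (1 : ℂ) : Matrix (Fin 2) (Fin 2) ℂ)
        = (Matrix.single o.2 o.2 (1 : ℂ))ᴴ * Matrix.single o.2 o.2 (1 : ℂ) := by
      simp [conjTranspose_single]
    rw [this]
    exact posSemidef_conjTranspose_mul_self _
  sum_op := by
    have h1 : ∑ b : Fin 2, Matrix.single b b (1 : ℂ) = 1 := by
      ext i j; fin_cases i <;> fin_cases j <;> simp [Fin.sum_univ_two, Matrix.single]
    ext ⟨i, a⟩ ⟨j, b⟩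
    have h2 := congrFun (congrFun Λ.sum_op i) j
    have h3 := congrFun (congrFun h1 a) b
    simp only [Matrix.sum_apply] at h2 h3
    simp only [Matrix.sum_apply, kroneckerMap_apply, Fintype.sum_prod_type]
    rw [← Finset.sum_mul_sum, h2, h3, ← one_kronecker_one, kroneckerMap_apply]

/-- `exp(-i t A)` for a Hermitian matrix `A` and a real `t`. -/
def expUnitary (A : Matrix n n ℂ) (hA : A.IsHermitian) (t : ℝ) : unitaryGroup n ℂ :=
  ⟨NormedSpace.exp ((-Complex.I * (t : ℂ)) • A), by
    rw [mem_unitaryGroup_iff', star_eq_conjTranspose, ← exp_conjTranspose,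
      ← Matrix.exp_add_of_commute]
    · rw [conjTranspose_smul, hA.eq]
      simp
    · rw [conjTranspose_smul, hA.eq]
      exact ((Commute.refl A).smul_left _).smul_right _⟩

/-- The gate `A ⊗ |0⟩⟨0| + B ⊗ |1⟩⟨1|` controlled by an ancilla qubit. -/
def controlled (A B : unitaryGroup n ℂ) : unitaryGroup (n × Fin 2) ℂ :=
  ⟨(A : Matrix n n ℂ) ⊗ₖ Matrix.single (0 : Fin 2) (0 : Fin 2) (1 : ℂ)
      + (B : Matrix n n ℂ) ⊗ₖ Matrix.single (1 : Fin 2) (1 : Fin 2) (1 : ℂ), by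
    have hA := (mem_unitaryGroup_iff').1 A.2
    have hB := (mem_unitaryGroup_iff').1 B.2
    rw [star_eq_conjTranspose] at hA hB
    rw [mem_unitaryGroup_iff', star_eq_conjTranspose, conjTranspose_add, conjTranspose_kronecker,
      conjTranspose_kronecker, add_mul, mul_add, mul_add, ← mul_kronecker_mul, ← mul_kronecker_mul,
      ← mul_kronecker_mul, ← mul_kronecker_mul, hA, hB]
    simp only [conjTranspose_single, star_one]
    rw [single_mul_single_same, single_mul_single_same, single_mul_single_of_ne _ _ _ _ (by simp),
      single_mul_single_of_ne _ _ _ _ (by simp), kronecker_zero, kronecker_zero, add_zero, zero_add,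
      mul_one, ← kronecker_add, ← one_kronecker_one]
    congr 1
    ext i j; fin_cases i <;> fin_cases j <;> simp [Matrix.single]⟩

/-- The gate `U ⊗ 𝟙`, acting trivially on the ancilla qubit. -/
def onSystem (U : unitaryGroup n ℂ) : unitaryGroup (n × Fin 2) ℂ := controlled U U

end Born

/-! ### Qubit registers -/

/-- Labels of the computational basis of `d` qubits. -/
abbrev Basis (d : ℕ) : Type := Fin d → Fin 2

/-- The tensor product `A₁ ⊗ ⋯ ⊗ A_d` of single-qubit matrices. -/
def tensor {d : ℕ} (A : Fin d → Matrix (Fin 2) (Fin 2) ℂ) : Matrix (Basis d) (Basis d) ℂ :=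
  Matrix.of fun x y => ∏ q, A q (x q) (y q)

lemma tensor_mul {d : ℕ} (A B : Fin d → Matrix (Fin 2) (Fin 2) ℂ) :
    tensor A * tensor B = tensor fun q => A q * B q := by
  ext x y
  simp only [tensor, Matrix.mul_apply, Matrix.of_apply, ← Finset.prod_mul_distrib]
  rw [Finset.prod_univ_sum, Fintype.piFinset_univ]

lemma tensor_one {d : ℕ} : tensor (fun _ : Fin d => (1 : Matrix (Fin 2) (Fin 2) ℂ)) = 1 := by
  ext x y
  simp only [tensor, Matrix.of_apply, Matrix.one_apply]
  by_cases h : x = y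
  · simp [h]
  · obtain ⟨q, hq⟩ := Function.ne_iff.1 h
    rw [if_neg h]
    exact Finset.prod_eq_zero (Finset.mem_univ q) (if_neg hq)

lemma tensor_conjTranspose {d : ℕ} (A : Fin d → Matrix (Fin 2) (Fin 2) ℂ) :
    (tensor A)ᴴ = tensor fun q => (A q)ᴴ := by
  ext x y
  simp [tensor, conjTranspose_apply]

/-- The tensor product of single-qubit unitaries. -/
def tensorUnitary {d : ℕ} (A : Fin d → unitaryGroup (Fin 2) ℂ) : unitaryGroup (Basis d) ℂ :=
  ⟨tensor fun q => (A q : Matrix (Fin 2) (Fin 2) ℂ), by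
    rw [mem_unitaryGroup_iff', star_eq_conjTranspose, tensor_conjTranspose, tensor_mul,
      ← tensor_one]
    congr 1
    funext q
    have := (mem_unitaryGroup_iff').1 (A q).2
    rwa [star_eq_conjTranspose] at this⟩

/-- The matrix `𝟙 ⊗ ⋯ ⊗ A ⊗ ⋯ ⊗ 𝟙`, with `A` in position `p`. -/
def onQubit {d : ℕ} (p : Fin d) (A : Matrix (Fin 2) (Fin 2) ℂ) : Matrix (Basis d) (Basis d) ℂ :=
  tensor (Function.update (fun _ => 1) p A)

/-- The names of the Pauli matrices. -/
inductive Pauli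
  | X
  | Y
  | Z

/-- The Pauli matrices. -/
def Pauli.mat : Pauli → Matrix (Fin 2) (Fin 2) ℂ
  | .X => !![0, 1; 1, 0]
  | .Y => !![0, -Complex.I; Complex.I, 0]
  | .Z => !![1, 0; 0, -1]

lemma Pauli.isHermitian (σ : Pauli) : σ.mat.IsHermitian := by
  ext i j; cases σ <;> fin_cases i <;> fin_cases j <;> simp [Pauli.mat, conjTranspose_apply]

lemma Pauli.mul_self (σ : Pauli) : σ.mat * σ.mat = 1 := by
  ext i j; cases σ <;> fin_cases i <;> fin_cases j <;> simp [Pauli.mat, Matrix.mul_apply]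

/-- The Pauli operator `σ` acting on qubit `p`. -/
def pauliOn {d : ℕ} (p : Fin d) (σ : Pauli) : Matrix (Basis d) (Basis d) ℂ := onQubit p σ.mat

lemma pauliOn_isHermitian {d : ℕ} (p : Fin d) (σ : Pauli) : (pauliOn p σ).IsHermitian := by
  unfold Matrix.IsHermitian pauliOn onQubit
  rw [tensor_conjTranspose]
  congr 1
  funext q
  by_cases h : q = p
  · subst h; simpa using σ.isHermitian.eq
  · simp [Function.update_of_ne h]

lemma pauliOn_mul_self {d : ℕ} (p : Fin d) (σ : Pauli) : pauliOn p σ * pauliOn p σ = 1 := by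
  unfold pauliOn onQubit
  rw [tensor_mul, ← tensor_one]
  congr 1
  funext q
  by_cases h : q = p
  · subst h; simpa using σ.mul_self
  · simp [Function.update_of_ne h]

/-- The sign `±1` of a measurement outcome, as a real number. -/
def sgn (u : ℤˣ) : ℝ := ((u : ℤ) : ℝ)

/-- The projector `(𝟙 + u σ_p)/2` onto the eigenspace of the Pauli operator `σ_p` on qubit `p`
for the eigenvalue `u = ±1`. -/
def pauliProj {d : ℕ} (p : Fin d) (σ : Pauli) (u : ℤˣ) : Matrix (Basis d) (Basis d) ℂ :=
  (1 / 2 : ℂ) • (1 + (sgn u : ℂ) • pauliOn p σ)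

lemma pauliProj_isHermitian {d : ℕ} (p : Fin d) (σ : Pauli) (u : ℤˣ) :
    (pauliProj p σ u)ᴴ = pauliProj p σ u := by
  simp [pauliProj, conjTranspose_smul, conjTranspose_add, (pauliOn_isHermitian p σ).eq]

lemma pauliProj_mul_self {d : ℕ} (p : Fin d) (σ : Pauli) (u : ℤˣ) :
    pauliProj p σ u * pauliProj p σ u = pauliProj p σ u := by
  have hu : (sgn u : ℂ) * (sgn u : ℂ) = 1 := by
    rcases Int.units_eq_one_or u with rfl | rfl <;> simp [sgn]
  have hs : (sgn u : ℂ) • pauliOn p σ * (sgn u : ℂ) • pauliOn p σ = 1 := by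
    rw [smul_mul_smul_comm, hu, pauliOn_mul_self, one_smul]
  unfold pauliProj
  rw [smul_mul_smul_comm, add_mul, mul_add, mul_add, one_mul, one_mul, mul_one, hs]
  module

lemma sum_pauliProj {d : ℕ} (p : Fin d) (σ : Pauli) : ∑ u : ℤˣ, pauliProj p σ u = 1 := by
  have : (Finset.univ : Finset ℤˣ) = {1, -1} := by decide
  rw [this, Finset.sum_pair (by decide)]
  simp only [pauliProj, sgn]
  push_cast
  module

/-- The measurement of qubit `p` along the eigenvectors of the Pauli matrix `σ`. -/
def qubitMeasurement {d : ℕ} (p : Fin d) (σ : Pauli) : POVM ℤˣ (Basis d) :=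
  POVM.ofKraus (pauliProj p σ) (by
    simp only [pauliProj_isHermitian, pauliProj_mul_self, sum_pauliProj])

/-- The sequential measurement: measure qubit `p` along the eigenvectors of `σ` (outcome `u`), let
the post-measurement state evolve by `W`, then measure qubit `q` along the eigenvectors of `τ`
(outcome `w`).  The outcome `(u, w)` has probability `‖Q_w W P_u ψ‖²`. -/
def sequentialMeasurement {d : ℕ} (p : Fin d) (σ : Pauli) (W : unitaryGroup (Basis d) ℂ)
    (q : Fin d) (τ : Pauli) : POVM (ℤˣ × ℤˣ) (Basis d) :=
  POVM.ofKraus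
    (fun o => pauliProj q τ o.2 * (W : Matrix (Basis d) (Basis d) ℂ) * pauliProj p σ o.1) (by
    have hW := (mem_unitaryGroup_iff').1 W.2
    rw [star_eq_conjTranspose] at hW
    rw [Fintype.sum_prod_type]
    have key : ∀ u w : ℤˣ,
        (pauliProj q τ w * (W : Matrix (Basis d) (Basis d) ℂ) * pauliProj p σ u)ᴴ
          * (pauliProj q τ w * (W : Matrix (Basis d) (Basis d) ℂ) * pauliProj p σ u)
        = pauliProj p σ u * (W : Matrix (Basis d) (Basis d) ℂ)ᴴ * pauliProj q τ w
          * ((W : Matrix (Basis d) (Basis d) ℂ) * pauliProj p σ u) := by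
      intro u w
      rw [conjTranspose_mul, conjTranspose_mul, pauliProj_isHermitian, pauliProj_isHermitian]
      simp only [Matrix.mul_assoc]
      rw [← Matrix.mul_assoc (pauliProj q τ w) (pauliProj q τ w), pauliProj_mul_self]
    simp only [key, ← Finset.sum_mul, ← Finset.mul_sum, sum_pauliProj]
    have key2 : ∀ u : ℤˣ, pauliProj p σ u * (W : Matrix (Basis d) (Basis d) ℂ)ᴴ * 1
          * ((W : Matrix (Basis d) (Basis d) ℂ) * pauliProj p σ u) = pauliProj p σ u := by
      intro u
      rw [Matrix.mul_one, Matrix.mul_assoc, ← Matrix.mul_assoc (W : Matrix (Basis d) (Basis d) ℂ)ᴴ,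
        hW, Matrix.one_mul, pauliProj_mul_self]
    simp only [key2, sum_pauliProj])

/-! ### The learning model -/

/-- The coordinates `(a, p)` (layer, qubit) of the parameters. -/
abbrev Coord (L d : ℕ) : Type := Fin L × Fin d

/-- The space `ℝᶜ` of parameters, with its Euclidean structure. -/
abbrev Params (L d : ℕ) : Type := EuclideanSpace ℝ (Coord L d)

/-- The number `c = d L` of parameters, as a real number. -/
def numParams (L d : ℕ) : ℝ := ((L * d : ℕ) : ℝ)

/-- A supervised learning model with quantum data: a circuit with `L` layers on `d` qubits, labelled
pure states `(φ_x, y)` with `(x, y)` distributed according to `Q`, a predictor `Λ` and a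
loss `ℓ ≥ 0`. -/
structure Model (L d : ℕ) (X Y : Type*) [Fintype X] [Fintype Y] where
  /-- the Pauli matrix of the rotation on qubit `p` in layer `a` -/
  pauli : Fin L → Fin d → Pauli
  /-- the fixed unitary that ends layer `a` -/
  fixed : Fin L → unitaryGroup (Basis d) ℂ
  /-- the joint distribution of feature and label -/
  Q : PMF (X × Y)
  /-- the pure state of feature `x` -/
  state : X → PureState (Basis d)
  /-- the measurement that predicts the label -/
  Λ : POVM Y (Basis d)
  /-- the loss: `ℓ y z` for the true label `y` and the predicted label `z` -/
  ℓ : Y → Y → ℝ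
  ℓ_nonneg : ∀ y z, 0 ≤ ℓ y z

namespace Model

variable {L d : ℕ} {X Y : Type*} [Fintype X] [Fintype Y] (M : Model L d X Y)

/-- The layer `W_a(θ) = V_a (⊗_p exp(-i θ_{(a,p)} σ_p^a / 2))`. -/
def layer (θ : Params L d) (a : Fin L) : unitaryGroup (Basis d) ℂ :=
  M.fixed a * tensorUnitary fun p =>
    expUnitary (M.pauli a p).mat (M.pauli a p).isHermitian (θ (a, p) / 2)

/-- The product `W_{n-1} ⋯ W_{m+1} W_m` of the layers with (zero-based) index in `[m, n)`. -/
def layers (θ : Params L d) (m : ℕ) : ℕ → unitaryGroup (Basis d) ℂ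
  | 0 => 1
  | n + 1 => if h : m ≤ n ∧ n < L then M.layer θ ⟨n, h.2⟩ * layers θ m n else layers θ m n

/-- The circuit `U(θ)`, the product of all the layers. -/
def circuit (θ : Params L d) : unitaryGroup (Basis d) ℂ := M.layers θ 0 L

/-- The expected loss `𝓛(θ) = 𝔼_{(x,y)∼Q} 𝔼[ℓ(y, ŷ)]`, where the prediction `ŷ` results from the
measurement of `U(θ)|φ_x⟩` by `Λ`. -/
def loss (θ : Params L d) : ℝ :=
  expect M.Q fun s => expect (born M.Λ ((M.state s.1).evolve (M.circuit θ))) fun z => M.ℓ s.2 z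

/-! ### The ensemble quantum Fisher information metric -/

/-- The ensemble fidelity `|∑ₓ Q_X(x) ⟨φ_x(θ)|φ_x(θ')⟩|²`, with `|φ_x(θ)⟩ = U(θ)|φ_x⟩`. -/
def ensembleFidelity (θ θ' : Params L d) : ℝ :=
  ‖∑ x, (((M.Q.map Prod.fst) x).toReal : ℂ) *
    (star ((M.state x).evolve (M.circuit θ)).vec ⬝ᵥ ((M.state x).evolve (M.circuit θ')).vec)‖ ^ 2

/-- The ensemble distance. -/
def ensembleDist (θ θ' : Params L d) : ℝ :=
  Real.sqrt (2 - 2 * Real.sqrt (M.ensembleFidelity θ θ'))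

/-- The ensemble quantum Fisher information metric: the matrix with entries
`(1/2) ∂²/∂δᵢ∂δⱼ d_E(θ, θ + δ)²` at `δ = 0`. -/
def EQFIM (θ : Params L d) : Matrix (Coord L d) (Coord L d) ℝ :=
  Matrix.of fun i j => 1 / 2 *
    deriv (fun s : ℝ => deriv (fun r : ℝ =>
      M.ensembleDist θ
        (θ + s • EuclideanSpace.single i 1 + r • EuclideanSpace.single j 1) ^ 2) 0) 0

/-! ### The single-shot estimators -/

/-- The outcomes `(v₁, v₂, (u₁, w₁), (u₂, w₂))` of the measurements for the metric. -/
abbrev MetricOutcome : Type := ℤˣ × ℤˣ × (ℤˣ × ℤˣ) × (ℤˣ × ℤˣ)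

/-- The outcome of the measurement of qubit `q` along the eigenvectors of `σ_q^b` in front of layer
`b`, on a fresh sample; here `j = (b, q)`. -/
def singleLaw (θ : Params L d) (j : Coord L d) : PMF ℤˣ :=
  M.Q.bind fun s => born (qubitMeasurement j.2 (M.pauli j.1 j.2))
    ((M.state s.1).evolve (M.layers θ 0 j.1))

/-- The outcomes of the sequential measurement of qubit `p` along the eigenvectors of `σ_p^a` in
front of layer `a` and then of qubit `q` along the eigenvectors of `σ_q^b` in front of layer `b`, on
a fresh sample; here `i = (a, p)` and `j = (b, q)` with `a ≤ b`. -/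
def sequentialLaw (θ : Params L d) (i j : Coord L d) : PMF (ℤˣ × ℤˣ) :=
  M.Q.bind fun s => born
    (sequentialMeasurement i.2 (M.pauli i.1 i.2) (M.layers θ i.1 j.1) j.2 (M.pauli j.1 j.2))
    ((M.state s.1).evolve (M.layers θ 0 i.1))

/-- The law of the outcomes of the measurements, on four independent samples, for the metric. -/
def metricLaw (θ : Params L d) (i j : Coord L d) : PMF MetricOutcome :=
  (M.singleLaw θ j).bind fun v₁ => (M.singleLaw θ j).bind fun v₂ =>
    (M.sequentialLaw θ i j).bind fun s₁ => (M.sequentialLaw θ i j).bind fun s₂ =>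
      PMF.pure (v₁, v₂, s₁, s₂)

/-- The single-shot estimator `g_i` of `∂𝓛/∂θᵢ`, for `i = (a, p)`, on a fresh sample `(φ_x, y)`: the
state in front of layer `a` gets an ancilla qubit in the state `|+⟩`, the gate
`exp(iπΣ/4) ⊗ |0⟩⟨0| + exp(-iπΣ/4) ⊗ |1⟩⟨1|` with `Σ = σ_p^a` on qubit `p` and the layers from `a`
on are applied, and the measurement `{Λ_ŷ ⊗ |b⟩⟨b|}` gives `g_i = (-1)^{1+b} ℓ(y, ŷ)`. -/
def partialLaw (θ : Params L d) (i : Coord L d) : PMF ℝ :=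
  M.Q.bind fun s =>
    (born M.Λ.withAncilla
      (((((M.state s.1).evolve (M.layers θ 0 i.1)).withPlus).evolve
        (controlled
          (expUnitary (pauliOn i.2 (M.pauli i.1 i.2)) (pauliOn_isHermitian _ _) (-(Real.pi / 4)))
          (expUnitary (pauliOn i.2 (M.pauli i.1 i.2)) (pauliOn_isHermitian _ _) (Real.pi / 4)))
        ).evolve (onSystem (M.layers θ i.1 L)))).map
      fun o => (-1) ^ (1 + (o.2 : ℕ)) * M.ℓ s.2 o.1

/-- The law of `(g_i, g_j)`, from two independent samples. -/
def gradLaw (θ : Params L d) (i j : Coord L d) : PMF (ℝ × ℝ) :=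
  (M.partialLaw θ i).bind fun gi => (M.partialLaw θ j).bind fun gj => PMF.pure (gi, gj)

end Model

section Algorithm

variable (L d : ℕ)

/-- The `2 × 2` matrix `Z̃_{[i,j]}` computed from the outcomes of the measurements. -/
def zTilde (β : ℝ) : Model.MetricOutcome → Matrix (Fin 2) (Fin 2) ℝ
  | (v₁, v₂, (u₁, w₁), (u₂, w₂)) =>
    let z : ℝ := (sgn u₁ * sgn w₁ + sgn u₂ * sgn w₂) / 8
      - 1 / 4 * ((sgn u₁ + sgn u₂) / 2) * ((sgn v₁ + sgn v₂) / 2)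
    !![(1 - sgn u₁ * sgn u₂) / (4 * (numParams L d - 1)) + β, z;
       z, (1 - sgn v₁ * sgn v₂) / (4 * (numParams L d - 1)) + β]

/-- The `2 × 2` matrix `Z̃_{[i,j]} - (2β/c) 𝟙`. -/
def zShifted (β : ℝ) (o : Model.MetricOutcome) : Matrix (Fin 2) (Fin 2) ℝ :=
  zTilde L d β o - (2 * β / numParams L d) • 1

variable {L d}

/-- The `c × c` matrix with the `2 × 2` block `A` in the rows and columns `i, j`, and zero
elsewhere. -/
def embed (i j : Coord L d) (A : Matrix (Fin 2) (Fin 2) ℝ) :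
    Matrix (Coord L d) (Coord L d) ℝ :=
  Matrix.of fun k l =>
    if k = i ∧ l = i then A 0 0 else if k = i ∧ l = j then A 0 1
    else if k = j ∧ l = i then A 1 0 else if k = j ∧ l = j then A 1 1 else 0

/-- The estimator `Z̄(i,j) = (c(c-1)/2) (Z̃ - (2β/c) 𝟙)` of the metric. -/
def zBar (β : ℝ) (i j : Coord L d) (o : Model.MetricOutcome) :
    Matrix (Coord L d) (Coord L d) ℝ :=
  (numParams L d * (numParams L d - 1) / 2) •
    (embed i j (zTilde L d β o) - (2 * β / numParams L d) • 1)

/-- The estimator `(c/2) (g_i e_i + g_j e_j)` of the gradient. -/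
def gradEstimator (i j : Coord L d) (g : ℝ × ℝ) : Coord L d → ℝ :=
  (numParams L d / 2) • (g.1 • Pi.single i 1 + g.2 • Pi.single j 1)

/-- One update `θ - η |Z̄(i,j)|⁻¹ g(i,j)`, with `|Z| = (Zᵀ Z)^{1/2}`. -/
def update (β η : ℝ) (i j : Coord L d) (o : Model.MetricOutcome) (g : ℝ × ℝ) (θ : Params L d) :
    Params L d :=
  θ - η • WithLp.toLp 2 ((CFC.abs (zBar β i j o))⁻¹ *ᵥ gradEstimator i j g)

/-- The two coordinates in the order in which the estimators use them: the earlier layer first. -/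
def orient (ij : Coord L d × Coord L d) : Coord L d × Coord L d :=
  if ij.1.1 ≤ ij.2.1 then ij else ij.swap

lemma offDiag_nonempty (hc : 2 < L * d) :
    (Finset.univ : Finset (Coord L d)).offDiag.Nonempty := by
  rw [← Finset.card_pos, Finset.offDiag_card, Finset.card_univ]
  simp only [Fintype.card_prod, Fintype.card_fin]
  nlinarith [Nat.sub_add_cancel (Nat.le_mul_self (L * d))]

/-- A uniformly random pair of distinct coordinates, in the order in which it is used. -/
def pairLaw (hc : 2 < L * d) : PMF (Coord L d × Coord L d) :=
  (PMF.uniformOfFinset (Finset.univ : Finset (Coord L d)).offDiag (offDiag_nonempty hc)).map orient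

end Algorithm

namespace Model

variable {L d : ℕ} {X Y : Type*} [Fintype X] [Fintype Y] (M : Model L d X Y)

/-- The law of the next iterate, given the current one: six fresh samples are used. -/
def stepLaw (hc : 2 < L * d) (β η : ℝ) (θ : Params L d) : PMF (Params L d) :=
  (pairLaw hc).bind fun ij => (M.metricLaw θ ij.1 ij.2).bind fun o =>
    (M.gradLaw θ ij.1 ij.2).bind fun g => PMF.pure (update β η ij.1 ij.2 o g θ)

/-- The law of the iterate `θ^(t)` of 2-QNSCD with regularization constant `β` and fixed learning
rate `η`, started at `θ₀`. -/
def iterLaw (hc : 2 < L * d) (β η : ℝ) (θ₀ : Params L d) : ℕ → PMF (Params L d)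
  | 0 => PMF.pure θ₀
  | t + 1 => (iterLaw hc β η θ₀ t).bind (M.stepLaw hc β η)

lemma partialLaw_support_finite (θ : Params L d) (i : Coord L d) :
    (M.partialLaw θ i).support.Finite := by
  unfold partialLaw
  rw [PMF.support_bind]
  refine Set.Finite.biUnion (Set.toFinite _) fun s _ => ?_
  rw [PMF.support_map]
  exact (Set.toFinite _).image _

lemma gradLaw_support_finite (θ : Params L d) (i j : Coord L d) :
    (M.gradLaw θ i j).support.Finite := by
  unfold gradLaw
  rw [PMF.support_bind]
  refine Set.Finite.biUnion (M.partialLaw_support_finite θ i) fun a _ => ?_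
  rw [PMF.support_bind]
  refine Set.Finite.biUnion (M.partialLaw_support_finite θ j) fun b _ => ?_
  rw [PMF.support_pure]
  exact Set.finite_singleton _

lemma iterLaw_support_finite (hc : 2 < L * d) (β η : ℝ) (θ₀ : Params L d) (t : ℕ) :
    (M.iterLaw hc β η θ₀ t).support.Finite := by
  induction t with
  | zero =>
    unfold iterLaw
    rw [PMF.support_pure]
    exact Set.finite_singleton _
  | succ t ih =>
    unfold iterLaw
    rw [PMF.support_bind]
    refine ih.biUnion fun θ _ => ?_
    unfold stepLaw
    rw [PMF.support_bind]
    refine Set.Finite.biUnion (Set.toFinite _) fun ij _ => ?_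
    rw [PMF.support_bind]
    refine Set.Finite.biUnion (Set.toFinite _) fun o _ => ?_
    rw [PMF.support_bind]
    refine Set.Finite.biUnion (M.gradLaw_support_finite θ _ _) fun g _ => ?_
    rw [PMF.support_pure]
    exact Set.finite_singleton _

/-! ### The assumptions and the constant of the error bound -/

/-- Pairwise `L₂`-smoothness of the loss. -/
def PairwiseSmooth (L₂ : ℝ) : Prop :=
  ∀ (i j : Coord L d) (θ : Params L d) (αi αj : ℝ),
    M.loss (θ + (αi • EuclideanSpace.single i 1 + αj • EuclideanSpace.single j 1))
      ≤ M.loss θ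
        + inner ℝ (gradient M.loss θ)
            (αi • EuclideanSpace.single i 1 + αj • EuclideanSpace.single j 1)
        + L₂ / 2 * ‖(αi • EuclideanSpace.single i 1 + αj • EuclideanSpace.single j 1 :
            Params L d)‖ ^ 2

/-- The regularized QGI inequality on the set `S`, with constants `β` and `μ`, for the minimum
`𝓛(θ⋆)` of the loss. -/
def RegularizedQGI (S : Set (Params L d)) (β μ : ℝ) (θstar : Params L d) : Prop :=
  ∀ θ ∈ S, μ * (M.loss θ - M.loss θstar) ≤
    1 / 2 * ((gradient M.loss θ).ofLp ⬝ᵥ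
      (((1 / (numParams L d - 1)) • M.EQFIM θ + (2 * β) • 1)⁻¹ *ᵥ (gradient M.loss θ).ofLp))

/-- The regularization constant `β` makes `Z̃_{[i,j]} - (2β/c) 𝟙` positive definite with
probability one, for all pairs of coordinates that can be chosen and all parameters in `S`. -/
def Regularizes (hc : 2 < L * d) (S : Set (Params L d)) (β : ℝ) : Prop :=
  ∀ θ ∈ S, ∀ ij ∈ (pairLaw hc).support, ∀ o ∈ (M.metricLaw θ ij.1 ij.2).support,
    (zShifted L d β o).PosDef

/-- The product `𝔼[‖|Z̃_{[i,j]} - (2β/c) 𝟙|⁻¹‖²] 𝔼[‖[g_i, g_j]‖²]` of moments of the estimators at the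
parameter `θ`, with the spectral norm of matrices and the Euclidean norm of vectors. -/
def momentProduct (β : ℝ) (θ : Params L d) (i j : Coord L d) : ℝ :=
  expect (M.metricLaw θ i j) (fun o =>
      ‖Matrix.toEuclideanCLM (𝕜 := ℝ) (CFC.abs (zShifted L d β o))⁻¹‖ ^ 2)
    * expect (M.gradLaw θ i j) (fun g => ‖!₂[g.1, g.2]‖ ^ 2)

/-- The moment products of all pairs of coordinates that can be chosen and all parameters
in `S`. -/
def momentSet (hc : 2 < L * d) (S : Set (Params L d)) (β : ℝ) : Set ℝ :=
  {m | ∃ θ ∈ S, ∃ ij ∈ (pairLaw hc).support, m = M.momentProduct β θ ij.1 ij.2}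

/-- The constant `α²`: the least upper bound of the moment products. -/
def alphaSq (hc : 2 < L * d) (S : Set (Params L d)) (β : ℝ) : ℝ := sSup (M.momentSet hc S β)

end Model

end QNSCD

end

/-! The argument is stochastic descent with a random 2 × 2 preconditioner, in which inverting the
estimated matrix is made harmless by convexity. For a chosen pair let `A` be `zShifted`, `g` the two
gradient estimates and `V` the inclusion of the two coordinates. Up to a positive factor the
estimator `zBar` is `A` on the range of `V` and the negative scalar `-2β/c` on its complement. The
absolute value only flips that scalar, which the gradient estimate does not see, so the step is `-τ
V A⁻¹ g` with `τ = η/(c-1)` (`update_eq`). Two exact means enter. By the parameter-shift rule `g` is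
unbiased for the partial derivatives (`expect_partialLaw_eq_gradient`). The Pauli measurements are
unbiased for the entries of the metric, which is a covariance of generators (`EQFIM_eq`,
`expect_zShifted_zero_one` and its companions). Pairwise smoothness bounds the new loss by a
first-order term `-τ v·A⁻¹g` and a second-order term controlled by `alphaSq`. Since `g` and `A` are
independent, the first becomes `-τ v·A⁻¹v`. As `v·A⁻¹v ≥ 2x·v - x·Ax` for every `x`
(`le_dotProduct_inv_mulVec`), and the right side is linear in `A`, the means over outcomes and pairs
can be taken (`expect_pairForm`). With `G = F/(c-1) + 2β𝟙` and the natural gradient `x = G⁻¹v`, the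
first-order decrease is at least `(2τ/c) v·G⁻¹v`, which the QGI inequality bounds below by `(4τμ/c)`
times the gap (`expect_loss_step_le`). This gives `a (t+1) ≤ (1 - r) a t + e` for the mean gap, with
`r = 4μη/(c(c-1))`. Iterating it needs `r ≤ 1`, which is not assumed: positive definiteness of `A`
bounds `G` below, smoothness bounds the gradient by the gap, and together they limit `μ` as soon as
`S` contains a nonoptimal point (`qgi_constant_le`). If there is none, all gaps vanish. -/

noncomputable section

namespace QNSCD

open Matrix
open scoped ComplexOrder MatrixOrder Kronecker

/-! ### Finitely supported laws and their expectations -/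

/-- A discrete law with finite support. -/
class FiniteSupport {α : Type*} (p : PMF α) : Prop where
  finite : p.support.Finite

namespace FiniteSupport

variable {α β : Type*}

instance of_finite [Finite α] (p : PMF α) : FiniteSupport p := ⟨Set.toFinite _⟩

instance pure (a : α) : FiniteSupport (PMF.pure a) :=
  ⟨by rw [PMF.support_pure]; exact Set.finite_singleton _⟩

instance bind (p : PMF α) (q : α → PMF β) [hp : FiniteSupport p] [hq : ∀ a, FiniteSupport (q a)] :
    FiniteSupport (p.bind q) :=
  ⟨by rw [PMF.support_bind]; exact hp.finite.biUnion fun a _ => (hq a).finite⟩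

instance map (p : PMF α) (f : α → β) [hp : FiniteSupport p] : FiniteSupport (p.map f) :=
  ⟨by rw [PMF.support_map]; exact hp.finite.image _⟩

end FiniteSupport

section Expect

variable {α β : Type*}

lemma expect_eq_sum [Fintype α] (p : PMF α) (f : α → ℝ) :
    expect p f = ∑ a, (p a).toReal * f a := tsum_fintype _

lemma expect_eq_sum_of_support_subset (p : PMF α) (f : α → ℝ) (T : Finset α)
    (h : p.support ⊆ T) : expect p f = ∑ a ∈ T, (p a).toReal * f a := by
  refine tsum_eq_sum fun a ha => ?_
  have : p a = 0 := by
    by_contra h0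
    exact ha (h ((p.mem_support_iff a).2 h0))
  simp [this]

lemma expect_eq_sum_toFinset (p : PMF α) [hp : FiniteSupport p] (f : α → ℝ) :
    expect p f = ∑ a ∈ hp.finite.toFinset, (p a).toReal * f a :=
  expect_eq_sum_of_support_subset p f _ (by simp)

lemma expect_pure (a : α) (f : α → ℝ) : expect (PMF.pure a) f = f a := by
  rw [expect_eq_sum_of_support_subset _ _ {a} (by simp)]
  simp

lemma expect_bind (p : PMF α) (q : α → PMF β) [hp : FiniteSupport p]
    [hq : ∀ a, FiniteSupport (q a)] (f : β → ℝ) :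
    expect (p.bind q) f = expect p fun a => expect (q a) f := by
  classical
  set T := hp.finite.toFinset
  -- One finite set carrying every `q a` with `a ∈ T`, so that the order of the two finite sums can
  -- be exchanged.
  set R := T.biUnion fun a => (hq a).finite.toFinset
  have hR : ∀ a ∈ T, (q a).support ⊆ R := fun a ha b hb =>
    Finset.mem_coe.2 (Finset.mem_biUnion.2 ⟨a, ha, by simpa using hb⟩)
  rw [expect_eq_sum_of_support_subset (p.bind q) f R, expect_eq_sum_toFinset p]
  · have h1 : ∀ b, ((p.bind q) b).toReal = ∑ a ∈ T, (p a).toReal * (q a b).toReal := by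
      intro b
      rw [PMF.bind_apply, tsum_eq_sum (s := T), ENNReal.toReal_sum]
      · simp
      · exact fun a _ => ENNReal.mul_ne_top (p.apply_ne_top a) ((q a).apply_ne_top b)
      · intro a ha
        have : p a = 0 := by
          by_contra h0
          exact ha (by simpa [T] using h0)
        simp [this]
    simp only [h1, Finset.sum_mul]
    rw [Finset.sum_comm]
    refine Finset.sum_congr rfl fun a ha => ?_
    rw [expect_eq_sum_of_support_subset (q a) f R (hR a ha), Finset.mul_sum]
    exact Finset.sum_congr rfl fun b _ => by ring
  · intro b hb
    rw [PMF.support_bind] at hb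
    simp only [Set.mem_iUnion] at hb
    obtain ⟨a, ha, hb⟩ := hb
    exact hR a (by simpa [T] using ha) hb

lemma expect_map (p : PMF α) [FiniteSupport p] (g : α → β) (f : β → ℝ) :
    expect (p.map g) f = expect p fun a => f (g a) := by
  have : p.map g = p.bind fun a => PMF.pure (g a) := rfl
  rw [this, expect_bind]
  simp only [expect_pure]

lemma expect_const (p : PMF α) [hp : FiniteSupport p] (r : ℝ) : expect p (fun _ => r) = r := by
  rw [expect_eq_sum_toFinset, ← Finset.sum_mul, ← ENNReal.toReal_sum fun a _ => p.apply_ne_top a]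
  have : ∑ a ∈ hp.finite.toFinset, p a = 1 := by
    rw [← p.tsum_coe]
    refine (tsum_eq_sum fun a ha => ?_).symm
    by_contra h0
    exact ha (by simpa using h0)
  simp [this]

lemma expect_add (p : PMF α) [FiniteSupport p] (f g : α → ℝ) :
    expect p (fun a => f a + g a) = expect p f + expect p g := by
  simp only [expect_eq_sum_toFinset, mul_add, Finset.sum_add_distrib]

lemma expect_const_mul (p : PMF α) (r : ℝ) (f : α → ℝ) :
    expect p (fun a => r * f a) = r * expect p f := by
  unfold expect
  rw [← tsum_mul_left]
  exact tsum_congr fun a => by ring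

lemma expect_mul_const (p : PMF α) (r : ℝ) (f : α → ℝ) :
    expect p (fun a => f a * r) = expect p f * r := by
  simp only [mul_comm _ r, expect_const_mul]

lemma expect_sub (p : PMF α) [FiniteSupport p] (f g : α → ℝ) :
    expect p (fun a => f a - g a) = expect p f - expect p g := by
  simp only [expect_eq_sum_toFinset, mul_sub, Finset.sum_sub_distrib]

lemma expect_mono (p : PMF α) [hp : FiniteSupport p] (f g : α → ℝ)
    (h : ∀ a ∈ p.support, f a ≤ g a) : expect p f ≤ expect p g := by
  rw [expect_eq_sum_toFinset, expect_eq_sum_toFinset]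
  exact Finset.sum_le_sum fun a ha =>
    mul_le_mul_of_nonneg_left (h a (by simpa using ha)) ENNReal.toReal_nonneg

lemma expect_congr (p : PMF α) {f g : α → ℝ}
    (h : ∀ a ∈ p.support, f a = g a) : expect p f = expect p g := by
  refine tsum_congr fun a => ?_
  by_cases ha : a ∈ p.support
  · rw [h a ha]
  · rw [PMF.mem_support_iff, not_not] at ha
    simp [ha]

lemma expect_nonneg (p : PMF α) {f : α → ℝ} (h : ∀ a ∈ p.support, 0 ≤ f a) : 0 ≤ expect p f := by
  refine tsum_nonneg fun a => ?_
  by_cases ha : a ∈ p.support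
  · exact mul_nonneg ENNReal.toReal_nonneg (h a ha)
  · rw [PMF.mem_support_iff, not_not] at ha
    simp [ha]

end Expect

/-! ### Quadratic forms of states -/

/-- The quadratic form `⟨ψ| A |ψ⟩`. -/
def qform {n : Type*} [Fintype n] (A : Matrix n n ℂ) (ψ : n → ℂ) : ℂ := star ψ ⬝ᵥ (A *ᵥ ψ)

section QForm

variable {n O : Type*} [Fintype n]

lemma qform_add (A B : Matrix n n ℂ) (ψ : n → ℂ) : qform (A + B) ψ = qform A ψ + qform B ψ := by
  simp [qform, add_mulVec]

lemma qform_smul (r : ℂ) (A : Matrix n n ℂ) (ψ : n → ℂ) : qform (r • A) ψ = r * qform A ψ := by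
  simp [qform, smul_mulVec]

lemma qform_sum (T : Finset O) (A : O → Matrix n n ℂ) (ψ : n → ℂ) :
    qform (∑ o ∈ T, A o) ψ = ∑ o ∈ T, qform (A o) ψ := by
  simp [qform, Matrix.sum_mulVec, dotProduct_sum]

lemma star_mulVec_dotProduct (B : Matrix n n ℂ) (ψ χ : n → ℂ) :
    star (B *ᵥ ψ) ⬝ᵥ χ = star ψ ⬝ᵥ (Bᴴ *ᵥ χ) := by
  rw [star_mulVec, dotProduct_mulVec]

lemma qform_mulVec (A B : Matrix n n ℂ) (ψ : n → ℂ) :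
    qform A (B *ᵥ ψ) = qform (Bᴴ * A * B) ψ := by
  simp only [qform, star_mulVec_dotProduct, mulVec_mulVec, Matrix.mul_assoc]

lemma star_qform (A : Matrix n n ℂ) (ψ : n → ℂ) : star (qform A ψ) = qform Aᴴ ψ := by
  rw [qform, star_dotProduct, star_mulVec_dotProduct, qform, star_star]

lemma qform_conjTranspose_re (A : Matrix n n ℂ) (ψ : n → ℂ) : (qform Aᴴ ψ).re = (qform A ψ).re := by
  rw [← star_qform]; simp

lemma qform_im_of_isHermitian {A : Matrix n n ℂ} (hA : A.IsHermitian) (ψ : n → ℂ) :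
    (qform A ψ).im = 0 := by
  have h := star_qform A ψ
  rw [hA.eq] at h
  exact Complex.conj_eq_iff_im.1 h

/-- A Pauli rotation turns a state into `cos • a - i sin • b`. Hence the loss along one coordinate
is a quadratic form in the cosine and sine of the half-angle, which is what makes the
parameter-shift rule exact. -/
lemma exists_qform_trig (A : Matrix n n ℂ) (a b : n → ℂ) :
    ∃ K₁ K₂ K₃ : ℝ, ∀ c s : ℝ, (qform A ((c : ℂ) • a - (Complex.I * (s : ℂ)) • b)).re
      = c ^ 2 * K₁ + s ^ 2 * K₂ + c * s * K₃ := by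
  refine ⟨(qform A a).re, (qform A b).re,
    (Complex.I * (star b ⬝ᵥ (A *ᵥ a)) - Complex.I * (star a ⬝ᵥ (A *ᵥ b))).re, fun c s => ?_⟩
  have : qform A ((c : ℂ) • a - (Complex.I * (s : ℂ)) • b)
      = ((c ^ 2 : ℝ) : ℂ) * qform A a + ((s ^ 2 : ℝ) : ℂ) * qform A b
        + ((c * s : ℝ) : ℂ)
          * (Complex.I * (star b ⬝ᵥ (A *ᵥ a)) - Complex.I * (star a ⬝ᵥ (A *ᵥ b))) := by
    simp only [qform, star_sub, star_smul, mulVec_sub, mulVec_smul, sub_dotProduct, dotProduct_sub,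
      smul_dotProduct, dotProduct_smul, smul_eq_mul, star_mul', RCLike.star_def,
      Complex.conj_ofReal, Complex.conj_I]
    push_cast
    linear_combination (-(s : ℂ) ^ 2 * (star b ⬝ᵥ (A *ᵥ b))) * Complex.I_sq
  rw [this]
  simp only [Complex.add_re, Complex.re_ofReal_mul]

end QForm

/-! ### Born's rule, the ancilla and Pauli exponentials -/

section Born

variable {n O : Type*} [Fintype n] [DecidableEq n] [Fintype O]

lemma born_toReal (E : POVM O n) (ψ : PureState n) (o : O) :
    (born E ψ o).toReal = (qform (E.op o) ψ.vec).re := by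
  rw [born, PMF.ofFintype_apply, ENNReal.toReal_ofReal]
  · rfl
  · exact (Complex.le_def.1 ((E.psd o).dotProduct_mulVec_nonneg ψ.vec)).1

lemma expect_born (E : POVM O n) (ψ : PureState n) (f : O → ℝ) :
    expect (born E ψ) f = (qform (∑ o, (f o : ℂ) • E.op o) ψ.vec).re := by
  rw [expect_eq_sum, qform_sum, Complex.re_sum]
  refine Finset.sum_congr rfl fun o _ => ?_
  rw [born_toReal, qform_smul, Complex.re_ofReal_mul, mul_comm]

lemma conjTranspose_mul_self_unitary (U : unitaryGroup n ℂ) :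
    (U : Matrix n n ℂ)ᴴ * (U : Matrix n n ℂ) = 1 := by
  have := (mem_unitaryGroup_iff').1 U.2
  rwa [star_eq_conjTranspose] at this

lemma PureState.evolve_evolve (U V : unitaryGroup n ℂ) (ψ : PureState n) :
    (ψ.evolve U).evolve V = ψ.evolve (V * U) := by
  simp [PureState.evolve, mulVec_mulVec]

/-- The control is diagonal in the basis in which the ancilla is measured, so the ancilla acts as a
fair coin choosing between `A` and `B`; the factor 1/2 is the square of the amplitude `1/√2`. -/
lemma withAncilla_qform (Λ : POVM O n) (V A B : unitaryGroup n ℂ) (ψ : PureState n) (o : O)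
    (b : Fin 2) :
    qform (Λ.withAncilla.op (o, b)) ((ψ.withPlus.evolve (controlled A B)).evolve (onSystem V)).vec
      = 1 / 2 * qform (Λ.op o) (ψ.evolve (V * if b = 0 then A else B)).vec := by
  have h2 : ((Real.sqrt 2 : ℝ) : ℂ)⁻¹ * ((Real.sqrt 2 : ℝ) : ℂ)⁻¹ = 1 / 2 := by
    rw [← mul_inv, ← Complex.ofReal_mul, Real.mul_self_sqrt (by norm_num)]; norm_num
  have hctrl : ∀ (A B : unitaryGroup n ℂ) (χ : n × Fin 2 → ℂ) (x : n) (b : Fin 2),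
      ((controlled A B : Matrix (n × Fin 2) (n × Fin 2) ℂ) *ᵥ χ) (x, b)
        = (((if b = 0 then A else B : unitaryGroup n ℂ) : Matrix n n ℂ) *ᵥ fun y => χ (y, b)) x := by
    intro A B χ x b
    simp only [controlled, mulVec, dotProduct, Fintype.sum_prod_type, Fin.sum_univ_two]
    refine Finset.sum_congr rfl fun y _ => ?_
    fin_cases b <;> simp [Matrix.single]
  have hvec : ∀ x b', ((ψ.withPlus.evolve (controlled A B)).evolve (onSystem V)).vec (x, b')
      = ((Real.sqrt 2 : ℝ) : ℂ)⁻¹ * (ψ.evolve (V * if b' = 0 then A else B)).vec x := by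
    intro x b'
    simp only [PureState.evolve, onSystem, hctrl, ite_self]
    have : (fun y : n => ψ.withPlus.vec (y, b')) = ((Real.sqrt 2 : ℝ) : ℂ)⁻¹ • ψ.vec := by
      funext y; simp [PureState.withPlus, mul_comm]
    rw [this, mulVec_smul]
    change ((V : Matrix n n ℂ) *ᵥ (((Real.sqrt 2 : ℝ) : ℂ)⁻¹ • _)) x = _
    rw [mulVec_smul, mulVec_mulVec]
    split_ifs <;> simp
  simp only [qform, dotProduct, mulVec, Fintype.sum_prod_type, Pi.star_apply, hvec,
    POVM.withAncilla, kroneckerMap_apply]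
  rw [Finset.mul_sum]
  refine Finset.sum_congr rfl fun x _ => ?_
  have hs : star (((Real.sqrt 2 : ℝ) : ℂ)⁻¹) = ((Real.sqrt 2 : ℝ) : ℂ)⁻¹ := by
    rw [RCLike.star_def, map_inv₀, Complex.conj_ofReal]
  rw [← h2, Fintype.sum_eq_single b]
  · rw [star_mul', hs]
    have : ∑ y, ∑ b', Λ.op o x y * Matrix.single b b (1 : ℂ) b b'
          * (((Real.sqrt 2 : ℝ) : ℂ)⁻¹ * (ψ.evolve (V * if b' = 0 then A else B)).vec y)
        = ((Real.sqrt 2 : ℝ) : ℂ)⁻¹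
          * ∑ y, Λ.op o x y * (ψ.evolve (V * if b = 0 then A else B)).vec y := by
      rw [Finset.mul_sum]
      refine Finset.sum_congr rfl fun y _ => ?_
      rw [Fintype.sum_eq_single b]
      · simp; ring
      · intro b' hb'
        simp [Matrix.single, hb'.symm]
    rw [this]
    ring
  · intro b' hb'
    simp [Matrix.single, hb'.symm]

/-- Even powers of an involution are `1` and odd powers are `A`, so the exponential series splits
into the cosine and sine series. -/
lemma expUnitary_eq (A : Matrix n n ℂ) (hA : A.IsHermitian) (h2 : A * A = 1) (t : ℝ) :
    (expUnitary A hA t : Matrix n n ℂ)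
      = (Real.cos t : ℂ) • 1 - (Complex.I * (Real.sin t : ℂ)) • A := by
  have heven : ∀ k, A ^ (2 * k) = 1 := fun k => by rw [pow_mul, pow_two, h2, one_pow]
  have hodd : ∀ k, A ^ (2 * k + 1) = A := fun k => by rw [pow_succ, heven, one_mul]
  have hc := (Complex.hasSum_cos' (-(t : ℂ))).smul_const (1 : Matrix n n ℂ)
  have hs := ((Complex.hasSum_sin' (-(t : ℂ))).mul_left Complex.I).smul_const A
  change NormedSpace.exp ((-Complex.I * (t : ℂ)) • A) = _
  rw [NormedSpace.exp_eq_tsum ℂ]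
  refine Eq.trans (HasSum.tsum_eq (HasSum.even_add_odd (m := Complex.cos (-(t : ℂ)) • 1)
    (m' := (Complex.I * Complex.sin (-(t : ℂ))) • A) ?_ ?_)) ?_
  · convert hc using 2 with k
    rw [smul_pow, heven, smul_smul, div_eq_inv_mul]
    congr 3; ring
  · convert hs using 2 with k
    rw [smul_pow, hodd, smul_smul, div_eq_inv_mul, div_eq_inv_mul]
    congr 1
    rw [mul_inv_cancel_left₀ Complex.I_ne_zero]
    congr 2; ring
  · simp only [Complex.cos_neg, Complex.sin_neg, Complex.ofReal_cos, Complex.ofReal_sin]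
    module

end Born

/-! ### Pauli measurements -/

section Qubits

variable {d : ℕ}

lemma sum_int_units {α : Type*} [AddCommMonoid α] (f : ℤˣ → α) : ∑ u : ℤˣ, f u = f 1 + f (-1) := by
  have : (Finset.univ : Finset ℤˣ) = {1, -1} := by decide
  rw [this, Finset.sum_pair (by decide)]

@[simp] lemma sgn_one : sgn 1 = 1 := by simp [sgn]

@[simp] lemma sgn_neg_one : sgn (-1) = -1 := by simp [sgn]

lemma sum_sgn_smul_pauliProj (p : Fin d) (σ : Pauli) :
    ∑ u : ℤˣ, (sgn u : ℂ) • pauliProj p σ u = pauliOn p σ := by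
  rw [sum_int_units]
  simp only [pauliProj, sgn_one, sgn_neg_one]
  push_cast
  module

lemma qubitMeasurement_op (p : Fin d) (σ : Pauli) (u : ℤˣ) :
    (qubitMeasurement p σ).op u = pauliProj p σ u := by
  simp [qubitMeasurement, POVM.ofKraus, pauliProj_isHermitian, pauliProj_mul_self]

lemma sequentialMeasurement_op (p : Fin d) (σ : Pauli) (W : unitaryGroup (Basis d) ℂ)
    (q : Fin d) (τ : Pauli) (u w : ℤˣ) :
    (sequentialMeasurement p σ W q τ).op (u, w)
      = pauliProj p σ u * ((W : Matrix (Basis d) (Basis d) ℂ)ᴴ * pauliProj q τ w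
          * (W : Matrix (Basis d) (Basis d) ℂ)) * pauliProj p σ u := by
  simp only [sequentialMeasurement, POVM.ofKraus, conjTranspose_mul, pauliProj_isHermitian,
    Matrix.mul_assoc]
  rw [← Matrix.mul_assoc (pauliProj q τ w) (pauliProj q τ w), pauliProj_mul_self]

/-- The later evolution and measurement sum to the identity, so they do not disturb the law of the
first outcome. -/
lemma sum_sgn_fst_sequentialMeasurement (p : Fin d) (σ : Pauli) (W : unitaryGroup (Basis d) ℂ)
    (q : Fin d) (τ : Pauli) :
    ∑ o : ℤˣ × ℤˣ, (sgn o.1 : ℂ) • (sequentialMeasurement p σ W q τ).op o = pauliOn p σ := by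
  rw [Fintype.sum_prod_type, ← sum_sgn_smul_pauliProj]
  refine Finset.sum_congr rfl fun u _ => ?_
  simp only [sequentialMeasurement_op]
  rw [← Finset.smul_sum, ← Finset.sum_mul, ← Finset.mul_sum, ← Finset.sum_mul, ← Finset.mul_sum,
    sum_pauliProj, Matrix.mul_one, conjTranspose_mul_self_unitary, Matrix.mul_one,
    pauliProj_mul_self]

/-- With `P_± = (1 ± A)/2` one has `P₊ B P₊ - P₋ B P₋ = (AB + BA)/2`. The sequential measurement
thus gives the symmetrized product, that is, the real part of the correlation in the metric. -/
lemma sum_sgn_mul_sequentialMeasurement (p : Fin d) (σ : Pauli) (W : unitaryGroup (Basis d) ℂ)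
    (q : Fin d) (τ : Pauli) :
    ∑ o : ℤˣ × ℤˣ, ((sgn o.1 * sgn o.2 : ℝ) : ℂ) • (sequentialMeasurement p σ W q τ).op o
      = (1 / 2 : ℂ) • (pauliOn p σ * ((W : Matrix (Basis d) (Basis d) ℂ)ᴴ * pauliOn q τ
          * (W : Matrix (Basis d) (Basis d) ℂ))
        + ((W : Matrix (Basis d) (Basis d) ℂ)ᴴ * pauliOn q τ
          * (W : Matrix (Basis d) (Basis d) ℂ)) * pauliOn p σ) := by
  set B := (W : Matrix (Basis d) (Basis d) ℂ)ᴴ * pauliOn q τ * (W : Matrix (Basis d) (Basis d) ℂ)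
    with hB
  have h : ∀ u : ℤˣ, ∑ w : ℤˣ, ((sgn u * sgn w : ℝ) : ℂ) • (sequentialMeasurement p σ W q τ).op (u, w)
      = (sgn u : ℂ) • (pauliProj p σ u * B * pauliProj p σ u) := by
    intro u
    simp only [sequentialMeasurement_op, Complex.ofReal_mul, mul_smul]
    rw [← Finset.smul_sum, hB, ← sum_sgn_smul_pauliProj q τ]
    simp only [Finset.mul_sum, Finset.sum_mul, Matrix.mul_smul, Matrix.smul_mul]
  rw [Fintype.sum_prod_type]
  simp only [h]
  rw [sum_int_units]
  simp only [pauliProj, sgn_one, sgn_neg_one, Matrix.mul_smul, Matrix.smul_mul, Matrix.mul_add,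
    Matrix.add_mul, Matrix.mul_one, Matrix.one_mul]
  push_cast
  module

lemma onQubit_sub_smul (p : Fin d) (a b : ℂ) (A : Matrix (Fin 2) (Fin 2) ℂ) :
    onQubit p (a • 1 - b • A) = a • 1 - b • onQubit p A := by
  have h : ∀ B : Matrix (Fin 2) (Fin 2) ℂ, ∀ x y : Basis d, onQubit p B x y
      = B (x p) (y p) * ∏ q ∈ Finset.univ.erase p, (1 : Matrix (Fin 2) (Fin 2) ℂ) (x q) (y q) := by
    intro B x y
    simp only [onQubit, tensor, Matrix.of_apply]
    rw [← Finset.mul_prod_erase _ _ (Finset.mem_univ p)]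
    simp only [Function.update_self]
    congr 1
    refine Finset.prod_congr rfl fun q hq => ?_
    rw [Function.update_of_ne (Finset.ne_of_mem_erase hq)]
  have h1 : (1 : Matrix (Basis d) (Basis d) ℂ) = onQubit p 1 := by
    rw [onQubit, ← tensor_one]; congr 1; funext q; simp
  ext x y
  rw [h1]
  simp only [Matrix.sub_apply, Matrix.smul_apply, h, smul_eq_mul]
  ring

end Qubits

/-! ### Perturbed circuits and the parameter-shift rule -/

lemma expUnitary_add {n : Type*} [Fintype n] [DecidableEq n] (A : Matrix n n ℂ)
    (hA : A.IsHermitian) (s t : ℝ) :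
    (expUnitary A hA (s + t) : Matrix n n ℂ)
      = (expUnitary A hA s : Matrix n n ℂ) * (expUnitary A hA t : Matrix n n ℂ) := by
  simp only [expUnitary]
  rw [← Matrix.exp_add_of_commute]
  · congr 1; push_cast; module
  · exact ((Commute.refl A).smul_left _).smul_right _

lemma differentiable_matrix_mul {E n : Type*} [NormedAddCommGroup E] [NormedSpace ℝ E] [Fintype n]
    {A B : E → Matrix n n ℂ} (hA : ∀ x y, Differentiable ℝ fun v => A v x y)
    (hB : ∀ x y, Differentiable ℝ fun v => B v x y) (x y : n) :
    Differentiable ℝ fun v => (A v * B v) x y := by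
  simp only [Matrix.mul_apply]
  exact Differentiable.fun_sum fun k _ => (hA x k).mul (hB k y)

lemma differentiable_finset_prod {E ι : Type*} [NormedAddCommGroup E] [NormedSpace ℝ E]
    (T : Finset ι) {f : ι → E → ℂ} (hf : ∀ i, Differentiable ℝ (f i)) :
    Differentiable ℝ fun v => ∏ i ∈ T, f i v := by
  classical
  induction T using Finset.induction_on with
  | empty => simp
  | insert i T hi ih =>
    simp only [Finset.prod_insert hi]
    exact (hf i).mul ih

namespace Model

variable {L d : ℕ} {X Y : Type*} [Fintype X] [Fintype Y] (M : Model L d X Y)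

/-- The generator `σ_p^a` on qubit `p` of the coordinate `(a, p)`. -/
def gen (j : Coord L d) : Matrix (Basis d) (Basis d) ℂ := pauliOn j.2 (M.pauli j.1 j.2)

lemma gen_isHermitian (j : Coord L d) : (M.gen j).IsHermitian := pauliOn_isHermitian _ _

lemma gen_mul_self (j : Coord L d) : M.gen j * M.gen j = 1 := pauliOn_mul_self _ _

/-- The rotation `exp(-i r σ_p^a / 2)` on qubit `p` generated by the coordinate `(a, p)`. -/
def rot (j : Coord L d) (r : ℝ) : unitaryGroup (Basis d) ℂ :=
  expUnitary (M.gen j) (M.gen_isHermitian j) (r / 2)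

lemma rot_eq (j : Coord L d) (r : ℝ) : (M.rot j r : Matrix (Basis d) (Basis d) ℂ)
    = (Real.cos (r / 2) : ℂ) • 1 - (Complex.I * (Real.sin (r / 2) : ℂ)) • M.gen j :=
  expUnitary_eq _ _ (M.gen_mul_self j) _

lemma rot_eq_onQubit (j : Coord L d) (r : ℝ) : (M.rot j r : Matrix (Basis d) (Basis d) ℂ)
    = onQubit j.2 (expUnitary (M.pauli j.1 j.2).mat (M.pauli j.1 j.2).isHermitian (r / 2)) := by
  rw [rot_eq, expUnitary_eq _ _ (Pauli.mul_self _), onQubit_sub_smul]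
  rfl

/-- Rotations on one qubit about a fixed axis add their angles, and the fixed unitary stands to the
left. A change of one parameter is therefore an extra gate acting just before its layer, where the
estimators measure. -/
lemma layer_add_single (θ : Params L d) (j : Coord L d) (r : ℝ) :
    M.layer (θ + r • EuclideanSpace.single j 1) j.1 = M.layer θ j.1 * M.rot j r := by
  apply Subtype.ext
  simp only [layer, Submonoid.coe_mul, tensorUnitary, rot_eq_onQubit, onQubit, Matrix.mul_assoc,
    tensor_mul]
  congr 2
  funext p
  by_cases h : p = j.2
  · subst h
    rw [Function.update_self, ← expUnitary_add]
    simp [add_div]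
  · have : ((j.1, p) : Coord L d) ≠ j := fun h' => h (by rw [← h'])
    rw [Function.update_of_ne h, Matrix.mul_one]
    simp [this]

lemma layer_add_single_of_ne (θ : Params L d) (j : Coord L d) (r : ℝ) {a : Fin L} (h : a ≠ j.1) :
    M.layer (θ + r • EuclideanSpace.single j 1) a = M.layer θ a := by
  have : ∀ p, ((a, p) : Coord L d) ≠ j := fun p h' => h (by rw [← h'])
  simp [layer, this]

lemma layers_of_le (θ : Params L d) {m n : ℕ} (h : n ≤ m) : M.layers θ m n = 1 := by
  induction n with
  | zero => rfl
  | succ n ih => rw [layers, dif_neg (by omega), ih (by omega)]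

lemma layers_succ (θ : Params L d) {m n : ℕ} (h : m ≤ n) (hn : n < L) :
    M.layers θ m (n + 1) = M.layer θ ⟨n, hn⟩ * M.layers θ m n := by
  rw [layers, dif_pos ⟨h, hn⟩]

lemma layers_mul_layers (θ : Params L d) {m k n : ℕ} (h : m ≤ k) (hk : k ≤ n) :
    M.layers θ k n * M.layers θ m k = M.layers θ m n := by
  induction n, hk using Nat.le_induction with
  | base => rw [layers_of_le _ _ le_rfl, one_mul]
  | succ n hn ih =>
    by_cases hL : n < L
    · rw [layers_succ _ _ hn hL, layers_succ _ _ (h.trans hn) hL, mul_assoc, ih]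
    · rw [layers, dif_neg (by omega), ih, layers, dif_neg (by omega)]

lemma layers_add_single_of_disjoint (θ : Params L d) (j : Coord L d) (r : ℝ) {m n : ℕ}
    (h : n ≤ j.1 ∨ (j.1 : ℕ) < m) :
    M.layers (θ + r • EuclideanSpace.single j 1) m n = M.layers θ m n := by
  induction n with
  | zero => rfl
  | succ n ih =>
    by_cases hn : m ≤ n ∧ n < L
    · rw [layers_succ _ _ hn.1 hn.2, layers_succ _ _ hn.1 hn.2, ih (by omega),
        layer_add_single_of_ne]
      intro h'
      have := congrArg Fin.val h'
      simp only at this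
      omega
    · rw [layers, dif_neg hn, layers, dif_neg hn, ih (by omega)]

lemma layers_add_single (θ : Params L d) (j : Coord L d) (r : ℝ) {m n : ℕ}
    (hm : m ≤ j.1) (hn : (j.1 : ℕ) < n) :
    M.layers (θ + r • EuclideanSpace.single j 1) m n
      = M.layers θ j.1 n * M.rot j r * M.layers θ m j.1 := by
  have h1 := M.layers_mul_layers (θ + r • EuclideanSpace.single j 1) (m := m) (k := j.1 + 1)
    (n := n) (by omega) hn
  have h2 := M.layers_mul_layers θ (m := j.1) (k := j.1 + 1) (n := n) (by omega) hn
  rw [← h1, ← h2, layers_succ _ _ hm j.1.2, layers_succ _ _ le_rfl j.1.2,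
    layers_add_single_of_disjoint _ _ _ _ (Or.inl le_rfl),
    layers_add_single_of_disjoint _ _ _ _ (Or.inr (Nat.lt_succ_self _)),
    layer_add_single, layers_of_le _ _ le_rfl]
  simp only [mul_assoc, one_mul]

lemma circuit_add_single (θ : Params L d) (j : Coord L d) (r : ℝ) :
    M.circuit (θ + r • EuclideanSpace.single j 1)
      = M.layers θ j.1 L * M.rot j r * M.layers θ 0 j.1 :=
  M.layers_add_single θ j r (Nat.zero_le _) j.1.2

/-- Equal layers, and even `i = j`, are included: the middle factor is then the identity. -/
lemma circuit_add_single_add_single (θ : Params L d) {i j : Coord L d} (h : i.1 ≤ j.1) (s r : ℝ) :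
    M.circuit (θ + s • EuclideanSpace.single i 1 + r • EuclideanSpace.single j 1)
      = M.layers θ j.1 L * M.rot j r * M.layers θ i.1 j.1 * M.rot i s * M.layers θ 0 i.1 := by
  rw [add_right_comm, circuit_add_single, layers_add_single _ _ _ _ h j.1.2,
    layers_add_single_of_disjoint _ _ _ _ (Or.inl h)]

lemma differentiable_layers (m n : ℕ) (x y : Basis d) :
    Differentiable ℝ fun θ : Params L d => (M.layers θ m n : Matrix (Basis d) (Basis d) ℂ) x y := by
  have hlayer : ∀ a x y, Differentiable ℝ
      fun θ : Params L d => (M.layer θ a : Matrix (Basis d) (Basis d) ℂ) x y := by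
    intro a x y
    have hrot : ∀ (p : Fin d) (k l : Fin 2), Differentiable ℝ fun θ : Params L d =>
        (expUnitary (M.pauli a p).mat (M.pauli a p).isHermitian (θ (a, p) / 2) :
          Matrix (Fin 2) (Fin 2) ℂ) k l := by
      intro p k l
      have hcos : Differentiable ℝ fun θ : Params L d => (Real.cos (θ (a, p) / 2) : ℂ) :=
        Complex.ofRealCLM.differentiable.comp
          (Real.differentiable_cos.comp (by fun_prop : Differentiable ℝ fun θ : Params L d => θ (a, p) / 2))
      have hsin : Differentiable ℝ fun θ : Params L d => (Real.sin (θ (a, p) / 2) : ℂ) :=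
        Complex.ofRealCLM.differentiable.comp
          (Real.differentiable_sin.comp (by fun_prop : Differentiable ℝ fun θ : Params L d => θ (a, p) / 2))
      simp only [expUnitary_eq _ _ (Pauli.mul_self _), Matrix.sub_apply, Matrix.smul_apply,
        smul_eq_mul]
      fun_prop
    have htensor : ∀ x y : Basis d, Differentiable ℝ fun θ : Params L d =>
        tensor (fun p => (expUnitary (M.pauli a p).mat (M.pauli a p).isHermitian (θ (a, p) / 2) :
          Matrix (Fin 2) (Fin 2) ℂ)) x y :=
      fun x y => by
        simp only [tensor, Matrix.of_apply]
        exact differentiable_finset_prod _ fun p => hrot p (x p) (y p)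
    exact differentiable_matrix_mul (A := fun _ => (M.fixed a : Matrix (Basis d) (Basis d) ℂ))
      (fun _ _ => differentiable_const _) htensor x y
  induction n generalizing x y with
  | zero => exact differentiable_const _
  | succ n ih =>
    by_cases hn : m ≤ n ∧ n < L
    · simp only [layers, dif_pos hn]
      exact differentiable_matrix_mul (hlayer _) ih x y
    · simpa only [layers, dif_neg hn] using ih x y

/-- The observable of the loss for the true label `y`. -/
def lossOp (y : Y) : Matrix (Basis d) (Basis d) ℂ := ∑ z, (M.ℓ y z : ℂ) • M.Λ.op z

lemma loss_eq (θ : Params L d) : M.loss θ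
    = expect M.Q fun s => (qform (M.lossOp s.2) ((M.state s.1).evolve (M.circuit θ)).vec).re := by
  simp only [loss, expect_born, lossOp]

/-- Needed to read the partial derivatives as components of `gradient`; derivatives along the
coordinates alone would not determine it. -/
lemma differentiable_loss : Differentiable ℝ M.loss := by
  have h : M.loss = fun θ => ∑ s, (M.Q s).toReal * Complex.reCLM
      (∑ x, (starRingEnd ℂ (∑ y, (M.circuit θ : Matrix (Basis d) (Basis d) ℂ) x y
          * (M.state s.1).vec y))
        * ∑ y, M.lossOp s.2 x y * ∑ k, (M.circuit θ : Matrix (Basis d) (Basis d) ℂ) y k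
          * (M.state s.1).vec k) := by
    funext θ
    rw [loss_eq, expect_eq_sum]
    rfl
  have hU : ∀ s x, Differentiable ℝ fun θ : Params L d =>
      ∑ y, (M.circuit θ : Matrix (Basis d) (Basis d) ℂ) x y * (M.state s).vec y :=
    fun s x => Differentiable.fun_sum fun y _ => (M.differentiable_layers 0 L x y).mul_const _
  rw [h]
  refine Differentiable.fun_sum fun s _ => Differentiable.const_mul
    (Complex.reCLM.differentiable.comp (Differentiable.fun_sum fun x _ => Differentiable.mul
      (Complex.conjCLE.differentiable.comp (hU s.1 x))
      (Differentiable.fun_sum fun y _ => (hU s.1 y).const_mul _))) _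

instance (θ : Params L d) (i : Coord L d) : FiniteSupport (M.partialLaw θ i) :=
  ⟨M.partialLaw_support_finite θ i⟩

instance (θ : Params L d) (i j : Coord L d) : FiniteSupport (M.gradLaw θ i j) :=
  ⟨M.gradLaw_support_finite θ i j⟩

lemma loss_add_single (θ : Params L d) (i : Coord L d) (r : ℝ) :
    M.loss (θ + r • EuclideanSpace.single i 1) = expect M.Q fun s =>
      (qform (M.lossOp s.2) (((M.state s.1).evolve (M.layers θ 0 i.1)).evolve
        (M.layers θ i.1 L * M.rot i r)).vec).re := by
  simp only [loss_eq, circuit_add_single, PureState.evolve_evolve]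

/-- The ancilla outcome selects the shift: `b = 0` goes with the rotation by `-π/2` and a minus
sign, `b = 1` with `π/2` and a plus sign, each with weight 1/2. -/
lemma expect_partialLaw (θ : Params L d) (i : Coord L d) :
    expect (M.partialLaw θ i) (fun g => g)
      = 1 / 2 * (M.loss (θ + (Real.pi / 2) • EuclideanSpace.single i 1)
        - M.loss (θ + (-(Real.pi / 2)) • EuclideanSpace.single i 1)) := by
  have h1 : Real.pi / 4 = Real.pi / 2 / 2 := by ring
  have h2 : -(Real.pi / 4) = -(Real.pi / 2) / 2 := by ring
  rw [partialLaw, expect_bind, loss_add_single, loss_add_single, ← expect_sub, ← expect_const_mul]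
  refine expect_congr _ fun s _ => ?_
  rw [expect_map, expect_eq_sum, Fintype.sum_prod_type, h2, h1]
  change ∑ z, ∑ b, (born M.Λ.withAncilla
      (((((M.state s.1).evolve (M.layers θ 0 i.1)).withPlus).evolve
        (controlled (M.rot i (-(Real.pi / 2))) (M.rot i (Real.pi / 2)))).evolve
          (onSystem (M.layers θ i.1 L))) (z, b)).toReal * ((-1) ^ (1 + (b : ℕ)) * M.ℓ s.2 z) = _
  simp only [born_toReal, withAncilla_qform, lossOp, qform_sum, qform_smul, Complex.re_sum,
    Complex.re_ofReal_mul, Fin.sum_univ_two, ← Finset.sum_sub_distrib, Finset.mul_sum]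
  refine Finset.sum_congr rfl fun z _ => ?_
  have h3 : ∀ w : ℂ, (1 / 2 * w).re = 1 / 2 * w.re := fun w => by
    simp [Complex.mul_re]
  simp only [h3, Fin.isValue, ↓reduceIte, one_ne_zero, Fin.val_zero, Fin.val_one]
  ring

/-- Along a coordinate the loss is `K₁ cos² + K₂ sin² + K₃ cos sin` in the half-angle; its slope at
0 and half its difference at `±π/2` are both `K₃/2`. -/
lemma hasDerivAt_loss_add_single (θ : Params L d) (i : Coord L d) :
    HasDerivAt (fun r : ℝ => M.loss (θ + r • EuclideanSpace.single i 1))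
      (expect (M.partialLaw θ i) fun g => g) 0 := by
  have hK := fun s : X × Y => exists_qform_trig (M.lossOp s.2)
    ((M.layers θ i.1 L : Matrix (Basis d) (Basis d) ℂ) *ᵥ
      ((M.state s.1).evolve (M.layers θ 0 i.1)).vec)
    ((M.layers θ i.1 L : Matrix (Basis d) (Basis d) ℂ) *ᵥ (M.gen i *ᵥ
      ((M.state s.1).evolve (M.layers θ 0 i.1)).vec))
  choose K₁ K₂ K₃ hK using hK
  have hloss : ∀ r : ℝ, M.loss (θ + r • EuclideanSpace.single i 1)
      = Real.cos (r / 2) ^ 2 * expect M.Q K₁ + Real.sin (r / 2) ^ 2 * expect M.Q K₂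
        + Real.cos (r / 2) * Real.sin (r / 2) * expect M.Q K₃ := by
    intro r
    rw [loss_add_single, ← expect_const_mul, ← expect_const_mul, ← expect_const_mul, ← expect_add,
      ← expect_add]
    refine expect_congr _ fun s _ => ?_
    rw [← hK]
    congr 2
    simp only [PureState.evolve, Submonoid.coe_mul, rot_eq, ← mulVec_mulVec, sub_mulVec,
      smul_mulVec, one_mulVec, mulVec_sub, mulVec_smul]
  -- At the half-angles `±π/4` the terms with `K₁` and `K₂` cancel, and `cos · sin` equals `±1/2`.
  have hval : expect (M.partialLaw θ i) (fun g => g) = 1 / 2 * expect M.Q K₃ := by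
    rw [expect_partialLaw, hloss, hloss]
    have h1 : Real.pi / 2 / 2 = Real.pi / 4 := by ring
    have h2 : -(Real.pi / 2) / 2 = -(Real.pi / 4) := by ring
    have h3 := Real.mul_self_sqrt (show (0 : ℝ) ≤ 2 by norm_num)
    rw [h1, h2, Real.cos_neg, Real.sin_neg, Real.cos_pi_div_four, Real.sin_pi_div_four]
    linear_combination (1 / 4 * expect M.Q K₃) * h3
  rw [hval]
  rw [show (fun r : ℝ => M.loss (θ + r • EuclideanSpace.single i 1)) = _ from funext hloss]
  have hl : HasDerivAt (fun r : ℝ => r / 2) (1 / 2) 0 := (hasDerivAt_id (0 : ℝ)).div_const 2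
  have hc := hl.cos
  have hs := hl.sin
  have := (((hc.pow 2).mul_const (expect M.Q K₁)).add ((hs.pow 2).mul_const (expect M.Q K₂))).add
    ((hc.mul hs).mul_const (expect M.Q K₃))
  refine HasDerivAt.congr_deriv this ?_
  simp

/-- The estimators of the partial derivatives of the loss are unbiased. -/
lemma expect_partialLaw_eq_gradient (θ : Params L d) (i : Coord L d) :
    expect (M.partialLaw θ i) (fun g => g) = gradient M.loss θ i := by
  have h1 : HasFDerivAt M.loss (fderiv ℝ M.loss θ) θ := (M.differentiable_loss θ).hasFDerivAt
  have h2 : HasDerivAt (fun r : ℝ => θ + r • (EuclideanSpace.single i 1 : Params L d))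
      (EuclideanSpace.single i 1) 0 := by
    simpa using ((hasDerivAt_id (0 : ℝ)).smul_const (EuclideanSpace.single i 1 : Params L d)).const_add θ
  have h3 : HasDerivAt (fun r : ℝ => M.loss (θ + r • EuclideanSpace.single i 1))
      (fderiv ℝ M.loss θ (EuclideanSpace.single i 1)) 0 :=
    h1.comp_hasDerivAt_of_eq (0 : ℝ) h2 (by simp)
  rw [(M.hasDerivAt_loss_add_single θ i).unique h3]
  have : fderiv ℝ M.loss θ (EuclideanSpace.single i 1)
      = inner ℝ (gradient M.loss θ) (EuclideanSpace.single i 1) := by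
    simp [gradient]
  rw [this, EuclideanSpace.inner_single_right]
  simp

end Model

/-! ### The metric as a covariance of generators -/

/-- The mixed second derivative at the origin of the squared distance `2 - 2 ‖z(s, r)‖`, for the
overlap `z` of two states that differ by two rotations with half-angle generators. -/
lemma deriv_deriv_sq_sqrt_overlap (z : ℝ → ℝ → ℂ) (m m' : ℝ) (κ : ℂ)
    (hz : ∀ s r, z s r = (Real.cos (s / 2) * Real.cos (r / 2) : ℝ)
      - Complex.I * (Real.sin (s / 2) * Real.cos (r / 2) * m : ℝ)
      - Complex.I * (Real.cos (s / 2) * Real.sin (r / 2) * m' : ℝ)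
      - (Real.sin (s / 2) * Real.sin (r / 2) : ℝ) * κ)
    (hle : ∀ s r, ‖z s r‖ ≤ 1) :
    1 / 2 * deriv (fun s : ℝ => deriv (fun r : ℝ =>
      Real.sqrt (2 - 2 * Real.sqrt (‖z s r‖ ^ 2)) ^ 2) 0) 0 = (κ.re - m * m') / 4 := by
  have hl : ∀ r₀ : ℝ, HasDerivAt (fun r : ℝ => r / 2) (1 / 2) r₀ :=
    fun r₀ => (hasDerivAt_id r₀).div_const 2
  have hsq : ∀ s r, Real.sqrt (2 - 2 * Real.sqrt (‖z s r‖ ^ 2)) ^ 2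
      = 2 - 2 * Real.sqrt (‖z s r‖ ^ 2) := by
    intro s r
    rw [Real.sq_sqrt]
    rw [Real.sqrt_sq (norm_nonneg _)]
    linarith [hle s r]
  have hnorm : ∀ s r, ‖z s r‖ ^ 2
      = (Real.cos (s / 2) * Real.cos (r / 2) - Real.sin (s / 2) * Real.sin (r / 2) * κ.re) ^ 2
        + (Real.sin (s / 2) * Real.cos (r / 2) * m + Real.cos (s / 2) * Real.sin (r / 2) * m'
          + Real.sin (s / 2) * Real.sin (r / 2) * κ.im) ^ 2 := by
    intro s r
    rw [← Complex.normSq_eq_norm_sq, Complex.normSq_apply, hz]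
    simp only [Complex.sub_re, Complex.sub_im, Complex.mul_re, Complex.mul_im, Complex.I_re,
      Complex.I_im, Complex.ofReal_re, Complex.ofReal_im]
    ring
  -- `P s` is `‖z s 0‖²` and `N s` is the derivative of `‖z s r‖²` in `r` at `r = 0`.
  set P : ℝ → ℝ := fun s => Real.cos (s / 2) ^ 2 + (Real.sin (s / 2) * m) ^ 2 with hP
  set N : ℝ → ℝ := fun s => Real.cos (s / 2) * Real.sin (s / 2) * (m * m' - κ.re)
    + Real.sin (s / 2) ^ 2 * (m * κ.im) with hN
  have hP0 : P 0 = 1 := by simp [hP]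
  have hN0 : N 0 = 0 := by simp [hN]
  have hPc : Continuous P := by fun_prop
  have hinner : ∀ s, P s ≠ 0 →
      deriv (fun r : ℝ => Real.sqrt (2 - 2 * Real.sqrt (‖z s r‖ ^ 2)) ^ 2) 0
        = -(N s / Real.sqrt (P s)) := by
    intro s hs
    simp only [hsq]
    simp only [hnorm]
    have hc := (hl 0).cos
    have hs' := (hl 0).sin
    have h1 := (((hc.const_mul (Real.cos (s / 2))).sub
      ((hs'.const_mul (Real.sin (s / 2))).mul_const κ.re)).pow 2).add
      (((((hc.const_mul (Real.sin (s / 2))).mul_const m).add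
        ((hs'.const_mul (Real.cos (s / 2))).mul_const m')).add
          ((hs'.const_mul (Real.sin (s / 2))).mul_const κ.im)).pow 2)
    have h2 := h1.sqrt (by simpa [hP] using hs)
    have h3 := (h2.const_mul 2).const_sub 2
    refine Eq.trans (HasDerivAt.deriv h3) ?_
    simp [hP, hN]
    ring
  have hev : (fun s => deriv (fun r : ℝ => Real.sqrt (2 - 2 * Real.sqrt (‖z s r‖ ^ 2)) ^ 2) 0)
      =ᶠ[nhds 0] fun s => -(N s / Real.sqrt (P s)) := by
    -- `P` can vanish far from the origin (for `m = 0` at `s = π`), where the square root is not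
    -- smooth; a formula near `s = 0` is enough.
    filter_upwards [hPc.continuousAt.eventually_ne (by rw [hP0]; exact one_ne_zero)] with s hs
    exact hinner s hs
  rw [hev.deriv_eq]
  have hPd : HasDerivAt P 0 0 := by
    have := (((hl 0).cos).pow 2).add ((((hl 0).sin).mul_const m).pow 2)
    refine HasDerivAt.congr_deriv this ?_
    simp
  have hNd : HasDerivAt N (1 / 2 * (m * m' - κ.re)) 0 := by
    have := ((((hl 0).cos).mul ((hl 0).sin)).mul_const (m * m' - κ.re)).add
      ((((hl 0).sin).pow 2).mul_const (m * κ.im))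
    refine HasDerivAt.congr_deriv this ?_
    simp
  -- Since `N 0 = 0` and `P 0 = 1`, only `N' 0` survives in the derivative of the quotient.
  have hfin := (hNd.div (hPd.sqrt (by rw [hP0]; exact one_ne_zero))
    (by rw [hP0]; simp)).neg
  refine Eq.trans (congrArg _ (HasDerivAt.deriv hfin)) ?_
  rw [hP0, hN0]
  simp
  ring

lemma norm_dotProduct_le {n : Type*} [Fintype n] (ψ χ : PureState n) :
    ‖star ψ.vec ⬝ᵥ χ.vec‖ ≤ 1 := by
  have h : ∀ φ : PureState n, ‖(WithLp.toLp 2 φ.vec : EuclideanSpace ℂ n)‖ = 1 := by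
    intro φ
    have h1 := inner_self_eq_norm_sq_to_K (𝕜 := ℂ) (WithLp.toLp 2 φ.vec : EuclideanSpace ℂ n)
    rw [EuclideanSpace.inner_eq_star_dotProduct, dotProduct_comm, φ.norm_one] at h1
    have h2 : ‖(WithLp.toLp 2 φ.vec : EuclideanSpace ℂ n)‖ ^ 2 = 1 := by
      refine Complex.ofReal_injective ?_
      rw [Complex.ofReal_pow, Complex.ofReal_one]
      exact h1.symm
    exact (pow_eq_one_iff_of_nonneg (norm_nonneg _) two_ne_zero).1 h2
  have := norm_inner_le_norm (𝕜 := ℂ) (WithLp.toLp 2 ψ.vec : EuclideanSpace ℂ n) (WithLp.toLp 2 χ.vec)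
  rw [h, h, EuclideanSpace.inner_eq_star_dotProduct, dotProduct_comm, one_mul] at this
  exact this

namespace Model

variable {L d : ℕ} {X Y : Type*} [Fintype X] [Fintype Y] (M : Model L d X Y)

/-- The mean of the Pauli outcome in front of the layer of a coordinate. -/
def mean (θ : Params L d) (i : Coord L d) : ℝ := expect (M.singleLaw θ i) sgn

/-- The mean of the product of the outcomes of the sequential measurement. -/
def corr (θ : Params L d) (i j : Coord L d) : ℝ :=
  expect (M.sequentialLaw θ i j) fun o => sgn o.1 * sgn o.2

instance (θ : Params L d) (i : Coord L d) : FiniteSupport (M.singleLaw θ i) :=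
  FiniteSupport.of_finite _

lemma mean_eq (θ : Params L d) (i : Coord L d) : M.mean θ i
    = expect M.Q fun s => (qform (M.gen i) ((M.state s.1).evolve (M.layers θ 0 i.1)).vec).re := by
  rw [mean, singleLaw, expect_bind]
  refine expect_congr _ fun s _ => ?_
  rw [expect_born]
  simp only [qubitMeasurement_op, sum_sgn_smul_pauliProj]
  rfl

lemma expect_sequentialLaw_fst (θ : Params L d) (i j : Coord L d) :
    expect (M.sequentialLaw θ i j) (fun o => sgn o.1) = M.mean θ i := by
  rw [mean_eq, sequentialLaw, expect_bind]
  refine expect_congr _ fun s _ => ?_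
  rw [expect_born, sum_sgn_fst_sequentialMeasurement]
  rfl

lemma corr_eq (θ : Params L d) (i j : Coord L d) : M.corr θ i j
    = expect M.Q fun s => (qform ((M.layers θ i.1 j.1 : Matrix (Basis d) (Basis d) ℂ)ᴴ * M.gen j
      * (M.layers θ i.1 j.1 : Matrix (Basis d) (Basis d) ℂ) * M.gen i)
        ((M.state s.1).evolve (M.layers θ 0 i.1)).vec).re := by
  rw [corr, sequentialLaw, expect_bind]
  refine expect_congr _ fun s _ => ?_
  rw [expect_born, sum_sgn_mul_sequentialMeasurement]
  set W := (M.layers θ i.1 j.1 : Matrix (Basis d) (Basis d) ℂ)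
  change (qform ((1 / 2 : ℂ) • (M.gen i * (Wᴴ * M.gen j * W) + Wᴴ * M.gen j * W * M.gen i)) _).re = _
  -- The two orders of the product are adjoint to each other, so their quadratic forms have the same
  -- real part.
  have h : M.gen i * (Wᴴ * M.gen j * W) = (Wᴴ * M.gen j * W * M.gen i)ᴴ := by
    simp only [conjTranspose_mul, conjTranspose_conjTranspose, (M.gen_isHermitian _).eq,
      Matrix.mul_assoc]
  rw [h, qform_smul, qform_add]
  have h2 : ∀ w : ℂ, (1 / 2 * w).re = 1 / 2 * w.re := fun w => by simp [Complex.mul_re]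
  rw [h2, Complex.add_re, qform_conjTranspose_re]
  ring

/-- The overlap of the states at `θ` and `θ + s e_i + r e_j`. -/
lemma overlap_eq (θ : Params L d) {i j : Coord L d} (h : i.1 ≤ j.1) (s r : ℝ) (φ : PureState (Basis d)) :
    star (φ.evolve (M.circuit θ)).vec ⬝ᵥ (φ.evolve (M.circuit
        (θ + s • EuclideanSpace.single i 1 + r • EuclideanSpace.single j 1))).vec
      = (Real.cos (s / 2) * Real.cos (r / 2) : ℝ)
      - Complex.I * (Real.sin (s / 2) * Real.cos (r / 2)
        * (qform (M.gen i) (φ.evolve (M.layers θ 0 i.1)).vec).re : ℝ)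
      - Complex.I * (Real.cos (s / 2) * Real.sin (r / 2)
        * (qform (M.gen j) (φ.evolve (M.layers θ 0 j.1)).vec).re : ℝ)
      - (Real.sin (s / 2) * Real.sin (r / 2) : ℝ)
        * qform ((M.layers θ i.1 j.1 : Matrix (Basis d) (Basis d) ℂ)ᴴ * M.gen j
          * (M.layers θ i.1 j.1 : Matrix (Basis d) (Basis d) ℂ) * M.gen i)
            (φ.evolve (M.layers θ 0 i.1)).vec := by
  have hre : ∀ (k : Coord L d) (ψ : Basis d → ℂ), ((qform (M.gen k) ψ).re : ℂ) = qform (M.gen k) ψ :=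
    fun k ψ => Complex.ext rfl (qform_im_of_isHermitian (M.gen_isHermitian k) ψ).symm
  have hj : (φ.evolve (M.layers θ 0 j.1)).vec
      = (M.layers θ i.1 j.1 : Matrix (Basis d) (Basis d) ℂ) *ᵥ (φ.evolve (M.layers θ 0 i.1)).vec := by
    rw [← M.layers_mul_layers θ (Nat.zero_le _) h]
    simp [PureState.evolve, mulVec_mulVec]
  have hU : (φ.evolve (M.circuit θ)).vec
      = (M.layers θ j.1 L : Matrix (Basis d) (Basis d) ℂ) *ᵥ
        ((M.layers θ i.1 j.1 : Matrix (Basis d) (Basis d) ℂ) *ᵥ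
          (φ.evolve (M.layers θ 0 i.1)).vec) := by
    rw [← hj, circuit, ← M.layers_mul_layers θ (Nat.zero_le _) j.1.2.le]
    simp [PureState.evolve, mulVec_mulVec]
  have hU' : (φ.evolve (M.circuit
        (θ + s • EuclideanSpace.single i 1 + r • EuclideanSpace.single j 1))).vec
      = (M.layers θ j.1 L : Matrix (Basis d) (Basis d) ℂ) *ᵥ
        ((M.rot j r : Matrix (Basis d) (Basis d) ℂ) *ᵥ
        ((M.layers θ i.1 j.1 : Matrix (Basis d) (Basis d) ℂ) *ᵥ
          ((M.rot i s : Matrix (Basis d) (Basis d) ℂ) *ᵥ (φ.evolve (M.layers θ 0 i.1)).vec))) := by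
    rw [circuit_add_single_add_single _ _ h]
    simp [PureState.evolve, mulVec_mulVec, Matrix.mul_assoc]
  -- Generators are Hermitian, so the real parts may be replaced by the forms themselves; the layers
  -- after `j` then cancel by unitarity.
  simp only [Complex.ofReal_mul, hre]
  rw [hj, qform_mulVec, hU, hU']
  set W := (M.layers θ i.1 j.1 : Matrix (Basis d) (Basis d) ℂ) with hW
  have hWW : Wᴴ * W = 1 := conjTranspose_mul_self_unitary _
  have hunit := (φ.evolve (M.layers θ 0 i.1)).norm_one
  set ψ := (φ.evolve (M.layers θ 0 i.1)).vec
  rw [star_mulVec_dotProduct, mulVec_mulVec, conjTranspose_mul_self_unitary, one_mulVec,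
    star_mulVec_dotProduct, mulVec_mulVec, mulVec_mulVec, mulVec_mulVec]
  have hR : Wᴴ * (M.rot j r : Matrix (Basis d) (Basis d) ℂ) * W
        * (M.rot i s : Matrix (Basis d) (Basis d) ℂ)
      = ((Real.cos (s / 2) : ℂ) * (Real.cos (r / 2) : ℂ)) • 1
        - (Complex.I * (Real.sin (s / 2) : ℂ) * (Real.cos (r / 2) : ℂ)) • M.gen i
        - (Complex.I * (Real.cos (s / 2) : ℂ) * (Real.sin (r / 2) : ℂ)) • (Wᴴ * M.gen j * W)
        - ((Real.sin (s / 2) : ℂ) * (Real.sin (r / 2) : ℂ)) • (Wᴴ * M.gen j * W * M.gen i) := by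
    have hI : ∀ x y : ℂ, (Complex.I * x) * (Complex.I * y) = -(x * y) := fun x y => by
      linear_combination (x * y) * Complex.I_sq
    simp only [rot_eq, Matrix.mul_sub, Matrix.sub_mul, Matrix.mul_smul, Matrix.smul_mul,
      Matrix.mul_one, hWW, smul_smul, Matrix.one_mul, smul_sub, hI]
    module
  have hexp : star ψ ⬝ᵥ ((Wᴴ * (M.rot j r : Matrix (Basis d) (Basis d) ℂ) * W
        * (M.rot i s : Matrix (Basis d) (Basis d) ℂ)) *ᵥ ψ)
      = (Real.cos (s / 2) : ℂ) * (Real.cos (r / 2) : ℂ)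
        - (Complex.I * (Real.sin (s / 2) : ℂ) * (Real.cos (r / 2) : ℂ)) * qform (M.gen i) ψ
        - (Complex.I * (Real.cos (s / 2) : ℂ) * (Real.sin (r / 2) : ℂ)) * qform (Wᴴ * M.gen j * W) ψ
        - ((Real.sin (s / 2) : ℂ) * (Real.sin (r / 2) : ℂ)) * qform (Wᴴ * M.gen j * W * M.gen i) ψ := by
    rw [hR]
    simp only [qform, sub_mulVec, smul_mulVec, one_mulVec, dotProduct_sub, dotProduct_smul, hunit,
      smul_eq_mul, mul_one]
  refine Eq.trans ?_ (hexp.trans ?_)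
  · simp only [Matrix.mul_assoc]
  · ring

/-- The metric averages over the marginal of the features, whereas the estimators sample from `Q`.
-/
lemma sum_marginal (f : X → ℂ) : ∑ x, (((M.Q.map Prod.fst) x).toReal : ℂ) * f x
    = ∑ s, ((M.Q s).toReal : ℂ) * f s.1 := by
  have h : ∀ g : X → ℝ, ∑ x, ((M.Q.map Prod.fst) x).toReal * g x = ∑ s, (M.Q s).toReal * g s.1 := by
    intro g
    rw [← expect_eq_sum, ← expect_eq_sum, expect_map]
  apply Complex.ext
  · simpa [Complex.re_sum, Complex.re_ofReal_mul] using h fun x => (f x).re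
  · simpa [Complex.im_sum, Complex.im_ofReal_mul] using h fun x => (f x).im

lemma sum_weights : ∑ s, (M.Q s).toReal = 1 := by
  simpa [expect_eq_sum] using expect_const M.Q 1

/-- The ensemble overlap of the states at the parameters `θ` and `θ'`. -/
def overlap (θ θ' : Params L d) : ℂ := ∑ s, ((M.Q s).toReal : ℂ) *
  (star ((M.state s.1).evolve (M.circuit θ)).vec ⬝ᵥ ((M.state s.1).evolve (M.circuit θ')).vec)

lemma ensembleDist_eq (θ θ' : Params L d) :
    M.ensembleDist θ θ' = Real.sqrt (2 - 2 * Real.sqrt (‖M.overlap θ θ'‖ ^ 2)) := by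
  rw [ensembleDist, ensembleFidelity, sum_marginal]
  rfl

lemma norm_overlap_le (θ θ' : Params L d) : ‖M.overlap θ θ'‖ ≤ 1 := by
  rw [overlap, ← M.sum_weights]
  refine (norm_sum_le _ _).trans (Finset.sum_le_sum fun s _ => ?_)
  rw [norm_mul, Complex.norm_real, Real.norm_of_nonneg ENNReal.toReal_nonneg]
  exact mul_le_of_le_one_right ENNReal.toReal_nonneg (norm_dotProduct_le _ _)

/-- The complex correlation of the generators of two coordinates, the earlier layer first. -/
def complexCorr (θ : Params L d) (i j : Coord L d) : ℂ := ∑ s, ((M.Q s).toReal : ℂ) *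
  qform ((M.layers θ i.1 j.1 : Matrix (Basis d) (Basis d) ℂ)ᴴ * M.gen j
      * (M.layers θ i.1 j.1 : Matrix (Basis d) (Basis d) ℂ) * M.gen i)
    ((M.state s.1).evolve (M.layers θ 0 i.1)).vec

lemma complexCorr_re (θ : Params L d) (i j : Coord L d) :
    (M.complexCorr θ i j).re = M.corr θ i j := by
  rw [corr_eq, complexCorr, expect_eq_sum, Complex.re_sum]
  simp only [Complex.re_ofReal_mul]

lemma overlap_add_single_add_single (θ : Params L d) {i j : Coord L d} (h : i.1 ≤ j.1) (s r : ℝ) :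
    M.overlap θ (θ + s • EuclideanSpace.single i 1 + r • EuclideanSpace.single j 1)
      = (Real.cos (s / 2) * Real.cos (r / 2) : ℝ)
      - Complex.I * (Real.sin (s / 2) * Real.cos (r / 2) * M.mean θ i : ℝ)
      - Complex.I * (Real.cos (s / 2) * Real.sin (r / 2) * M.mean θ j : ℝ)
      - (Real.sin (s / 2) * Real.sin (r / 2) : ℝ) * M.complexCorr θ i j := by
  have h1 : ∀ c : ℂ, ∑ s, ((M.Q s).toReal : ℂ) * c = c := fun c => by
    rw [← Finset.sum_mul, ← Complex.ofReal_sum, sum_weights, Complex.ofReal_one, one_mul]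
  simp only [overlap, M.overlap_eq θ h, mul_sub, Finset.sum_sub_distrib, h1, mean_eq, complexCorr,
    expect_eq_sum, Complex.ofReal_mul, Complex.ofReal_sum, Finset.mul_sum]
  congr 1
  · congr 1
    · congr 1
      exact Finset.sum_congr rfl fun _ _ => by ring
    · exact Finset.sum_congr rfl fun _ _ => by ring
  · exact Finset.sum_congr rfl fun _ _ => by ring

lemma EQFIM_eq (θ : Params L d) {i j : Coord L d} (h : i.1 ≤ j.1) :
    M.EQFIM θ i j = (M.corr θ i j - M.mean θ i * M.mean θ j) / 4 := by
  rw [← complexCorr_re, ← deriv_deriv_sq_sqrt_overlap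
    (fun s r => M.overlap θ (θ + s • EuclideanSpace.single i 1 + r • EuclideanSpace.single j 1)) _ _ _
    (M.overlap_add_single_add_single θ h) fun _ _ => M.norm_overlap_le _ _]
  simp only [EQFIM, Matrix.of_apply, ensembleDist_eq]

/-- The overlap formula is invariant under exchanging the two angles together with the two means, so
the same second-derivative computation serves the other order of differentiation. -/
lemma EQFIM_swap_eq (θ : Params L d) {i j : Coord L d} (h : i.1 ≤ j.1) :
    M.EQFIM θ j i = (M.corr θ i j - M.mean θ i * M.mean θ j) / 4 := by
  rw [← complexCorr_re, mul_comm (M.mean θ i), ← deriv_deriv_sq_sqrt_overlap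
    (fun s r => M.overlap θ (θ + s • EuclideanSpace.single j 1 + r • EuclideanSpace.single i 1)) _ _ _
    (fun s r => ?_) fun _ _ => M.norm_overlap_le _ _]
  · simp only [EQFIM, Matrix.of_apply, ensembleDist_eq]
  · rw [add_right_comm, M.overlap_add_single_add_single θ h]
    push_cast
    ring

lemma corr_self (θ : Params L d) (i : Coord L d) : M.corr θ i i = 1 := by
  rw [corr_eq]
  refine (expect_congr _ fun s _ => ?_).trans (expect_const M.Q 1)
  rw [layers_of_le _ _ le_rfl]
  simp [gen_mul_self, qform, PureState.norm_one]

lemma EQFIM_self_eq (θ : Params L d) (i : Coord L d) :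
    M.EQFIM θ i i = (1 - M.mean θ i ^ 2) / 4 := by
  rw [EQFIM_eq _ _ le_rfl, corr_self, sq]

/-! ### Moments of the estimator of the metric -/

instance (θ : Params L d) (i j : Coord L d) : FiniteSupport (M.metricLaw θ i j) :=
  FiniteSupport.of_finite _

lemma expect_metricLaw (θ : Params L d) (i j : Coord L d) (f : MetricOutcome → ℝ) :
    expect (M.metricLaw θ i j) f
      = expect (M.singleLaw θ j) fun v₁ => expect (M.singleLaw θ j) fun v₂ =>
        expect (M.sequentialLaw θ i j) fun s₁ => expect (M.sequentialLaw θ i j) fun s₂ =>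
          f (v₁, v₂, s₁, s₂) := by
  simp only [metricLaw, expect_bind, expect_pure]

/-- The outcomes `u₁, u₂` come from independent samples, so their product has the squared mean as
expectation and `1 - u₁u₂` is unbiased for four times the diagonal entry. -/
lemma expect_zShifted_zero_zero (θ : Params L d) (i j : Coord L d) (β : ℝ) :
    expect (M.metricLaw θ i j) (fun o => zShifted L d β o 0 0)
      = M.EQFIM θ i i / (numParams L d - 1) + (β - 2 * β / numParams L d) := by
  have h : ∀ o : MetricOutcome, zShifted L d β o 0 0
      = (4 * (numParams L d - 1))⁻¹ * (1 - sgn o.2.2.1.1 * sgn o.2.2.2.1)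
        + (β - 2 * β / numParams L d) := by
    rintro ⟨v₁, v₂, ⟨u₁, w₁⟩, ⟨u₂, w₂⟩⟩
    simp [zShifted, zTilde, div_eq_inv_mul]
    ring
  simp only [h, expect_metricLaw, expect_add, expect_const_mul, expect_sub, expect_const,
    expect_mul_const, expect_sequentialLaw_fst, EQFIM_self_eq, mul_inv]
  ring

lemma expect_zShifted_one_one (θ : Params L d) (i j : Coord L d) (β : ℝ) :
    expect (M.metricLaw θ i j) (fun o => zShifted L d β o 1 1)
      = M.EQFIM θ j j / (numParams L d - 1) + (β - 2 * β / numParams L d) := by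
  have h : ∀ o : MetricOutcome, zShifted L d β o 1 1
      = (4 * (numParams L d - 1))⁻¹ * (1 - sgn o.1 * sgn o.2.1)
        + (β - 2 * β / numParams L d) := by
    rintro ⟨v₁, v₂, ⟨u₁, w₁⟩, ⟨u₂, w₂⟩⟩
    simp [zShifted, zTilde, div_eq_inv_mul]
    ring
  have hm : expect (M.singleLaw θ j) sgn = M.mean θ j := rfl
  simp only [h, expect_metricLaw, expect_add, expect_const_mul, expect_sub, expect_const,
    expect_mul_const, hm, EQFIM_self_eq, mul_inv]
  ring

/-- The first summand of `z` averages to a quarter of the correlation; the `u` and `v` outcomes are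
independent, so the second averages to a quarter of the product of means. -/
lemma expect_zShifted_zero_one (θ : Params L d) {i j : Coord L d} (hij : i.1 ≤ j.1) (β : ℝ) :
    expect (M.metricLaw θ i j) (fun o => zShifted L d β o 0 1) = M.EQFIM θ i j := by
  have h : ∀ o : MetricOutcome, zShifted L d β o 0 1
      = 1 / 8 * (sgn o.2.2.1.1 * sgn o.2.2.1.2 + sgn o.2.2.2.1 * sgn o.2.2.2.2)
        - 1 / 16 * ((sgn o.2.2.1.1 + sgn o.2.2.2.1) * (sgn o.1 + sgn o.2.1)) := by
    rintro ⟨v₁, v₂, ⟨u₁, w₁⟩, ⟨u₂, w₂⟩⟩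
    simp [zShifted, zTilde]
    ring
  have hm : expect (M.singleLaw θ j) sgn = M.mean θ j := rfl
  have hcorr : expect (M.sequentialLaw θ i j) (fun o => sgn o.1 * sgn o.2) = M.corr θ i j := rfl
  have hfin : FiniteSupport (M.sequentialLaw θ i j) := FiniteSupport.of_finite _
  simp only [h, expect_metricLaw, expect_add, expect_const_mul, expect_sub, expect_const,
    expect_mul_const, expect_sequentialLaw_fst, hm, hcorr, EQFIM_eq _ _ hij]
  ring

lemma zShifted_one_zero (β : ℝ) (o : MetricOutcome) :
    zShifted L d β o 1 0 = zShifted L d β o 0 1 := by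
  obtain ⟨v₁, v₂, ⟨u₁, w₁⟩, ⟨u₂, w₂⟩⟩ := o
  simp [zShifted, zTilde]

end Model

/-! ### The update as a preconditioned step in two coordinates -/

variable {L d : ℕ}

/-- The isometry of `ℝ²` into the parameter space that spans the coordinates `i, j`. -/
def pairIsometry (i j : Coord L d) : Matrix (Coord L d) (Fin 2) ℝ :=
  Matrix.of fun k l => (Pi.single (![i, j] l) 1 : Coord L d → ℝ) k

lemma pairIsometry_transpose_mul_self {i j : Coord L d} (h : i ≠ j) :
    (pairIsometry i j)ᵀ * pairIsometry i j = 1 := by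
  ext k l
  change (Pi.single (![i, j] k) 1 : Coord L d → ℝ) ⬝ᵥ Pi.single (![i, j] l) 1 = _
  rw [single_dotProduct, one_mul]
  fin_cases k <;> fin_cases l <;> simp [h, h.symm]

lemma embed_eq {i j : Coord L d} (h : i ≠ j) (A : Matrix (Fin 2) (Fin 2) ℝ) :
    embed i j A = pairIsometry i j * A * (pairIsometry i j)ᵀ := by
  ext k l
  simp only [embed, pairIsometry, Matrix.mul_apply, Fin.sum_univ_two, Matrix.of_apply,
    Matrix.transpose_apply, Matrix.cons_val_zero, Matrix.cons_val_one,
    Pi.single_apply]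
  by_cases h1 : k = i <;> by_cases h2 : l = i <;> by_cases h3 : k = j <;> by_cases h4 : l = j <;>
    simp_all

lemma pairIsometry_mulVec (i j : Coord L d) (w : Fin 2 → ℝ) :
    pairIsometry i j *ᵥ w = w 0 • Pi.single i 1 + w 1 • Pi.single j 1 := by
  funext k
  simp [pairIsometry, mulVec, dotProduct, Fin.sum_univ_two, mul_comm]

/-- The absolute value of a matrix that is positive on the range of an isometry `V` and a negative
scalar on its complement. -/
lemma cfcAbs_sub_smul {m n : Type*} [Fintype m] [DecidableEq m] [Fintype n] [DecidableEq n]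
    (V : Matrix m n ℝ) (hV : Vᵀ * V = 1) {A : Matrix n n ℝ} (hA : A.PosSemidef) {k b : ℝ}
    (hk : 0 ≤ k) (hb : 0 ≤ b) :
    CFC.abs (k • (V * A * Vᵀ - b • (1 - V * Vᵀ))) = k • (V * A * Vᵀ + b • (1 - V * Vᵀ)) := by
  have hAt : Aᵀ = A := by simpa using hA.isHermitian.eq
  set E := 1 - V * Vᵀ with hE
  have hEV : E * V = 0 := by rw [hE, Matrix.sub_mul, Matrix.mul_assoc, hV]; simp
  have hVE : Vᵀ * E = 0 := by rw [hE, Matrix.mul_sub, ← Matrix.mul_assoc, hV]; simp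
  have hEE : E * E = E := by
    have : E * E = E - V * (Vᵀ * E) := by
      nth_rewrite 1 [hE]
      rw [Matrix.sub_mul, Matrix.mul_assoc, Matrix.one_mul]
    rw [this, hVE, Matrix.mul_zero, sub_zero]
  have hEt : Eᵀ = E := by simp [hE, transpose_sub, transpose_mul]
  have hEp : E.PosSemidef := by
    have := posSemidef_conjTranspose_mul_self E
    rwa [conjTranspose_eq_transpose_of_trivial, hEt, hEE] at this
  have hVA : (V * A * Vᵀ).PosSemidef := by
    have := hA.mul_mul_conjTranspose_same V
    rwa [conjTranspose_eq_transpose_of_trivial] at this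
  have h1 : V * A * Vᵀ * E = 0 := by rw [Matrix.mul_assoc, hVE, Matrix.mul_zero]
  have h2 : E * (V * A * Vᵀ) = 0 := by rw [← Matrix.mul_assoc, ← Matrix.mul_assoc, hEV]; simp
  -- The candidate is positive semidefinite, and `V A Vᵀ` and `E` annihilate each other, so the sign
  -- of `b` disappears in the square.
  refine CFC.sqrt_unique ?_ ((hVA.add (hEp.smul hb)).smul hk).nonneg
  have hst : star (k • (V * A * Vᵀ - b • E)) = k • (V * A * Vᵀ - b • E) := by
    rw [star_eq_conjTranspose, conjTranspose_eq_transpose_of_trivial]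
    simp only [transpose_smul, transpose_sub, transpose_mul, transpose_transpose, hAt, hEt,
      Matrix.mul_assoc]
  rw [hst]
  simp only [Matrix.smul_mul, Matrix.mul_smul, Matrix.mul_add, Matrix.add_mul, Matrix.mul_sub,
    Matrix.sub_mul, h1, h2]
  module

/-- The matrix is block diagonal for the range of `V` and its complement, so its inverse acts on the
range through `A⁻¹` alone and `b` drops out. -/
lemma inv_add_smul_mulVec {m n : Type*} [Fintype m] [DecidableEq m] [Fintype n] [DecidableEq n]
    (V : Matrix m n ℝ) (hV : Vᵀ * V = 1) {A : Matrix n n ℝ} (hA : IsUnit A.det) {k b : ℝ}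
    (hk : k ≠ 0) (hb : b ≠ 0) (w : n → ℝ) :
    (k • (V * A * Vᵀ + b • (1 - V * Vᵀ)))⁻¹ *ᵥ (V *ᵥ w) = k⁻¹ • (V *ᵥ (A⁻¹ *ᵥ w)) := by
  set E := 1 - V * Vᵀ with hE
  have hEV : E * V = 0 := by rw [hE, Matrix.sub_mul, Matrix.mul_assoc, hV]; simp
  have hVE : Vᵀ * E = 0 := by rw [hE, Matrix.mul_sub, ← Matrix.mul_assoc, hV]; simp
  have hEE : E * E = E := by
    have : E * E = E - V * (Vᵀ * E) := by
      nth_rewrite 1 [hE]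
      rw [Matrix.sub_mul, Matrix.mul_assoc, Matrix.one_mul]
    rw [this, hVE, Matrix.mul_zero, sub_zero]
  have hinv : (k • (V * A * Vᵀ + b • E))⁻¹ = k⁻¹ • (V * A⁻¹ * Vᵀ + b⁻¹ • E) := by
    refine inv_eq_right_inv ?_
    have h1 : V * A * Vᵀ * E = 0 := by rw [Matrix.mul_assoc, hVE, Matrix.mul_zero]
    have h2 : E * (V * A⁻¹ * Vᵀ) = 0 := by rw [← Matrix.mul_assoc, ← Matrix.mul_assoc, hEV]; simp
    have h3 : V * A * Vᵀ * (V * A⁻¹ * Vᵀ) = V * Vᵀ := by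
      calc V * A * Vᵀ * (V * A⁻¹ * Vᵀ) = V * (A * ((Vᵀ * V) * A⁻¹)) * Vᵀ := by
            simp only [Matrix.mul_assoc]
        _ = V * Vᵀ := by rw [hV, Matrix.one_mul, mul_nonsing_inv _ hA, Matrix.mul_one]
    rw [smul_mul_smul_comm, mul_inv_cancel₀ hk, one_smul, Matrix.add_mul, Matrix.mul_add,
      Matrix.mul_add, h3, Matrix.mul_smul, h1, Matrix.smul_mul, h2, Matrix.smul_mul, Matrix.mul_smul,
      hEE, smul_smul, mul_inv_cancel₀ hb, hE]
    simp
  rw [hinv, smul_mulVec, mulVec_mulVec, mulVec_mulVec, Matrix.add_mul, Matrix.smul_mul, hEV,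
    Matrix.mul_assoc, hV, Matrix.mul_one]
  simp

lemma two_lt_numParams (hc : 2 < L * d) : 2 < numParams L d := by
  unfold numParams; exact_mod_cast hc

/-- The update moves the coordinates `i, j` by a preconditioned step. -/
lemma update_eq (hc : 2 < L * d) {β : ℝ} (hβ : 0 < β) (η : ℝ) {i j : Coord L d} (hij : i ≠ j)
    {o : Model.MetricOutcome} (ho : (zShifted L d β o).PosDef) (g : ℝ × ℝ) (θ : Params L d) :
    update β η i j o g θ = θ +
      ((-(η / (numParams L d - 1)) * ((zShifted L d β o)⁻¹ *ᵥ ![g.1, g.2]) 0) •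
          EuclideanSpace.single i 1
        + (-(η / (numParams L d - 1)) * ((zShifted L d β o)⁻¹ *ᵥ ![g.1, g.2]) 1) •
          EuclideanSpace.single j 1) := by
  have hc' := two_lt_numParams hc
  set c := numParams L d with hcdef
  set V := pairIsometry i j with hVdef
  have hV : Vᵀ * V = 1 := pairIsometry_transpose_mul_self hij
  -- Outside the pair `zTilde` contributes nothing, and only the subtracted multiple of the identity
  -- remains.
  have hZ : zBar β i j o = (c * (c - 1) / 2) •
      (V * zShifted L d β o * Vᵀ - (2 * β / c) • (1 - V * Vᵀ)) := by
    rw [zBar, embed_eq hij, ← hcdef, ← hVdef, zShifted, ← hcdef, Matrix.mul_sub, Matrix.sub_mul,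
      Matrix.mul_smul, Matrix.smul_mul, Matrix.mul_one]
    module
  have hG : gradEstimator i j g = (c / 2) • (V *ᵥ ![g.1, g.2]) := by
    rw [gradEstimator, hVdef, pairIsometry_mulVec]
    simp [hcdef]
  have hk : 0 < c * (c - 1) / 2 := by have : 0 < c - 1 := by linarith
                                      positivity
  have hb : 0 < 2 * β / c := by positivity
  have hdet : IsUnit (zShifted L d β o).det := ho.det_pos.ne'.isUnit
  -- The prefactors `c/2` of the gradient and `c(c-1)/2` of the metric leave `1/(c-1)`.
  rw [update, hZ, cfcAbs_sub_smul V hV ho.posSemidef hk.le hb.le, hG, mulVec_smul,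
    inv_add_smul_mulVec V hV hdet hk.ne' hb.ne', hVdef, pairIsometry_mulVec]
  have hc1 : c - 1 ≠ 0 := by linarith
  have hc0 : c ≠ 0 := by linarith
  ext k
  simp only [PiLp.sub_apply, PiLp.add_apply, PiLp.smul_apply, PiLp.single_apply,
    Pi.add_apply, Pi.smul_apply, Pi.single_apply, smul_eq_mul]
  field_simp
  ring

lemma norm_sq_pair {i j : Coord L d} (hij : i ≠ j) (a b : ℝ) :
    ‖(a • EuclideanSpace.single i 1 + b • EuclideanSpace.single j 1 : Params L d)‖ ^ 2
      = a ^ 2 + b ^ 2 := by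
  rw [← real_inner_self_eq_norm_sq, inner_add_left, inner_add_right, inner_add_right]
  simp [real_inner_smul_left, real_inner_smul_right, EuclideanSpace.inner_single_left, hij, hij.symm,
    norm_smul]

lemma inner_pair (v : Params L d) (i j : Coord L d) (a b : ℝ) :
    inner ℝ v (a • EuclideanSpace.single i 1 + b • EuclideanSpace.single j 1 : Params L d)
      = a * v i + b * v j := by
  rw [inner_add_right]
  simp [real_inner_smul_right, EuclideanSpace.inner_single_right]

/-- The variational bound for the quadratic form of the inverse of a positive matrix. -/
lemma le_dotProduct_inv_mulVec {n : Type*} [Fintype n] [DecidableEq n] {A : Matrix n n ℝ}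
    (hA : A.PosDef) (v x : n → ℝ) :
    2 * (x ⬝ᵥ v) - x ⬝ᵥ (A *ᵥ x) ≤ v ⬝ᵥ (A⁻¹ *ᵥ v) := by
  have hdet : IsUnit A.det := hA.det_pos.ne'.isUnit
  have hAt : Aᵀ = A := by simpa using hA.isHermitian.eq
  -- The claim is the expansion of `⟨y - x, A (y - x)⟩ ≥ 0` at `y = A⁻¹ v`, where the bound is
  -- attained.
  have h := hA.posSemidef.dotProduct_mulVec_nonneg (A⁻¹ *ᵥ v - x)
  have h1 : A *ᵥ (A⁻¹ *ᵥ v) = v := by rw [mulVec_mulVec, mul_nonsing_inv _ hdet, one_mulVec]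
  have h2 : (A⁻¹ *ᵥ v) ⬝ᵥ (A *ᵥ x) = x ⬝ᵥ v := by
    rw [dotProduct_mulVec, ← mulVec_transpose, hAt, h1, dotProduct_comm]
  have h3 : star (A⁻¹ *ᵥ v - x) = A⁻¹ *ᵥ v - x := star_trivial _
  rw [h3, mulVec_sub, h1, sub_dotProduct, dotProduct_sub, dotProduct_sub, h2,
    dotProduct_comm (A⁻¹ *ᵥ v) v] at h
  linarith

/-! ### Averages over pairs of coordinates -/

section Pairs

variable {L d : ℕ}

instance (hc : 2 < L * d) : FiniteSupport (pairLaw hc) := FiniteSupport.of_finite _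

lemma mem_support_pairLaw (hc : 2 < L * d) {ij : Coord L d × Coord L d}
    (h : ij ∈ (pairLaw hc).support) : ij.1 ≠ ij.2 ∧ ij.1.1 ≤ ij.2.1 := by
  rw [pairLaw, PMF.support_map] at h
  obtain ⟨p, hp, rfl⟩ := h
  have hp' : p.1 ≠ p.2 := by
    simpa using (PMF.mem_support_uniformOfFinset_iff _ _).1 hp
  unfold orient
  split_ifs with h
  · exact ⟨hp', h⟩
  · exact ⟨hp'.symm, (not_le.1 h).le⟩

lemma card_offDiag_coord :
    (((Finset.univ : Finset (Coord L d)).offDiag.card : ℕ) : ℝ)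
      = numParams L d * (numParams L d - 1) := by
  rw [Finset.offDiag_card, Finset.card_univ, Fintype.card_prod, Fintype.card_fin, Fintype.card_fin,
    Nat.cast_sub (Nat.le_mul_self _), numParams]
  push_cast
  ring

/-- The average of a symmetric function over the random pair of coordinates. -/
lemma expect_pairLaw (hc : 2 < L * d) (f : Coord L d → Coord L d → ℝ)
    (hf : ∀ i j, f i j = f j i) :
    expect (pairLaw hc) (fun ij => f ij.1 ij.2)
      = (∑ i, ∑ j, f i j - ∑ i, f i i) / (numParams L d * (numParams L d - 1)) := by
  -- Symmetry of `f` makes the orientation irrelevant, leaving the uniform law on ordered pairs.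
  have h1 : ∀ p : Coord L d × Coord L d, f (orient p).1 (orient p).2 = f p.1 p.2 := by
    intro p
    unfold orient
    split_ifs
    · rfl
    · exact hf _ _
  have h2 : ∑ p ∈ (Finset.univ : Finset (Coord L d)).offDiag, f p.1 p.2
      = ∑ i, ∑ j, f i j - ∑ i, f i i := by
    have hu : (Finset.univ : Finset (Coord L d × Coord L d))
        = (Finset.univ : Finset (Coord L d)).diag ∪ (Finset.univ : Finset (Coord L d)).offDiag := by
      rw [Finset.diag_union_offDiag, Finset.univ_product_univ]
    rw [eq_sub_iff_add_eq, ← Fintype.sum_prod_type', hu,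
      Finset.sum_union (Finset.disjoint_diag_offDiag _), add_comm, Finset.sum_diag]
  rw [pairLaw, expect_map]
  simp only [h1]
  rw [expect_eq_sum_of_support_subset _ _ (Finset.univ : Finset (Coord L d)).offDiag
    (by rw [PMF.support_uniformOfFinset])]
  rw [← h2, ← card_offDiag_coord, div_eq_inv_mul, Finset.mul_sum]
  refine Finset.sum_congr rfl fun p hp => ?_
  rw [PMF.uniformOfFinset_apply_of_mem _ hp, ENNReal.toReal_inv, ENNReal.toReal_natCast]

/-- A given coordinate belongs to the random pair with probability `2/c`. -/
lemma expect_pairLaw_add (hc : 2 < L * d) (a : Coord L d → ℝ) :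
    expect (pairLaw hc) (fun ij => a ij.1 + a ij.2) = 2 / numParams L d * ∑ i, a i := by
  have hc' := two_lt_numParams hc
  have hc1 : numParams L d - 1 ≠ 0 := by linarith
  have hc0 : numParams L d ≠ 0 := by linarith
  rw [expect_pairLaw hc (fun i j => a i + a j) fun i j => add_comm _ _]
  have h : ∑ i, ∑ j, (a i + a j) - ∑ i, (a i + a i) = 2 * (numParams L d - 1) * ∑ i, a i := by
    simp only [Finset.sum_add_distrib, Finset.sum_const, nsmul_eq_mul, ← Finset.mul_sum]
    have : ((Finset.univ : Finset (Coord L d)).card : ℝ) = numParams L d := by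
      simp [numParams]
    rw [this]
    ring
  rw [h]
  field_simp

/-- Each diagonal entry occurs in `2(c-1)` ordered pairs and each off-diagonal entry in one; the
weight `1/(2(c-1))` balances them. This is why the diagonal of `zTilde` carries `1/(c-1)`. -/
lemma expect_pairLaw_offDiag (hc : 2 < L * d) (F : Coord L d → Coord L d → ℝ)
    (hF : ∀ i j, F i j = F j i) :
    expect (pairLaw hc) (fun ij => F ij.1 ij.2
        + (F ij.1 ij.1 + F ij.2 ij.2) / (2 * (numParams L d - 1)))
      = (∑ i, ∑ j, F i j) / (numParams L d * (numParams L d - 1)) := by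
  have hc' := two_lt_numParams hc
  have hc1 : numParams L d - 1 ≠ 0 := by linarith
  have hc0 : numParams L d ≠ 0 := by linarith
  rw [expect_add, expect_pairLaw hc F hF]
  simp only [div_eq_inv_mul (_ + _), expect_const_mul]
  rw [expect_pairLaw_add hc fun i => F i i]
  field_simp
  ring

end Pairs

/-! ### Expected descent in one step -/

namespace Model

variable {L d : ℕ} {X Y : Type*} [Fintype X] [Fintype Y] (M : Model L d X Y)

lemma EQFIM_symm (θ : Params L d) (i j : Coord L d) : M.EQFIM θ i j = M.EQFIM θ j i := by
  rcases le_total i.1 j.1 with h | h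
  · rw [EQFIM_eq _ _ h, EQFIM_swap_eq _ _ h]
  · rw [EQFIM_eq _ _ h, EQFIM_swap_eq _ _ h]

/-- The quadratic form of the mean of the estimator for the pair `i, j`. -/
def pairForm (β : ℝ) (θ : Params L d) (x : Coord L d → ℝ) (i j : Coord L d) : ℝ :=
  x i ^ 2 * (M.EQFIM θ i i / (numParams L d - 1) + (β - 2 * β / numParams L d))
    + x j ^ 2 * (M.EQFIM θ j j / (numParams L d - 1) + (β - 2 * β / numParams L d))
    + 2 * (x i * x j * M.EQFIM θ i j)

lemma expect_zShifted_form (β : ℝ) (θ : Params L d) (x : Coord L d → ℝ) {i j : Coord L d}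
    (hij : i.1 ≤ j.1) :
    expect (M.metricLaw θ i j) (fun o => ![x i, x j] ⬝ᵥ (zShifted L d β o *ᵥ ![x i, x j]))
      = M.pairForm β θ x i j := by
  have h : ∀ o, ![x i, x j] ⬝ᵥ (zShifted L d β o *ᵥ ![x i, x j])
      = x i ^ 2 * zShifted L d β o 0 0 + x j ^ 2 * zShifted L d β o 1 1
        + 2 * (x i * x j * zShifted L d β o 0 1) := by
    intro o
    simp [mulVec, dotProduct, Fin.sum_univ_two, zShifted_one_zero]
    ring
  simp only [h, expect_add, expect_const_mul, expect_zShifted_zero_zero, expect_zShifted_one_one,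
    expect_zShifted_zero_one _ _ hij, pairForm]

/-- The regularized metric of the QGI inequality. -/
def regMetric (β : ℝ) (θ : Params L d) : Matrix (Coord L d) (Coord L d) ℝ :=
  (1 / (numParams L d - 1)) • M.EQFIM θ + (2 * β) • 1

/-- The diagonal shift `β - 2β/c` of the estimator falls short of the `2β` in `regMetric` by `β(1 +
2/c)`, whence the subtracted term. -/
lemma expect_pairForm (hc : 2 < L * d) (β : ℝ) (θ : Params L d) (x : Coord L d → ℝ) :
    expect (pairLaw hc) (fun ij => M.pairForm β θ x ij.1 ij.2)
      = 2 / numParams L d * (x ⬝ᵥ (M.regMetric β θ *ᵥ x)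
        - β * (1 + 2 / numParams L d) * (x ⬝ᵥ x)) := by
  have hc' := two_lt_numParams hc
  have hc1 : numParams L d - 1 ≠ 0 := by linarith
  have hc0 : numParams L d ≠ 0 := by linarith
  have h : ∀ ij : Coord L d × Coord L d, M.pairForm β θ x ij.1 ij.2
      = (β - 2 * β / numParams L d) * (x ij.1 ^ 2 + x ij.2 ^ 2)
        + 2 * (x ij.1 * x ij.2 * M.EQFIM θ ij.1 ij.2
          + (x ij.1 * x ij.1 * M.EQFIM θ ij.1 ij.1 + x ij.2 * x ij.2 * M.EQFIM θ ij.2 ij.2)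
            / (2 * (numParams L d - 1))) := by
    intro ij
    unfold pairForm
    field_simp
    ring
  simp only [h]
  rw [expect_add, expect_const_mul, expect_const_mul, expect_pairLaw_add hc fun i => x i ^ 2,
    expect_pairLaw_offDiag hc (fun i j => x i * x j * M.EQFIM θ i j) fun i j => by
      rw [M.EQFIM_symm θ i j, mul_comm (x i)]]
  have h1 : x ⬝ᵥ (M.regMetric β θ *ᵥ x)
      = (∑ i, ∑ j, x i * x j * M.EQFIM θ i j) / (numParams L d - 1) + 2 * β * (x ⬝ᵥ x) := by
    rw [regMetric, add_mulVec, smul_mulVec, smul_mulVec, one_mulVec, dotProduct_add,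
      dotProduct_smul, dotProduct_smul, smul_eq_mul, smul_eq_mul, one_div, ← div_eq_inv_mul]
    congr 2
    simp only [dotProduct, mulVec, Finset.mul_sum]
    exact Finset.sum_congr rfl fun i _ => Finset.sum_congr rfl fun j _ => by ring
  have h2 : x ⬝ᵥ x = ∑ i, x i ^ 2 := by simp [dotProduct, sq]
  rw [h1, h2]
  field_simp
  ring

lemma expect_gradLaw (θ : Params L d) (i j : Coord L d) (f : ℝ × ℝ → ℝ) :
    expect (M.gradLaw θ i j) f = expect (M.partialLaw θ i) fun a =>
      expect (M.partialLaw θ j) fun b => f (a, b) := by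
  simp only [gradLaw, expect_bind, expect_pure]

/-- Applied with `B` the inverse of the sampled metric block: its samples are independent of those
for the gradient, so it counts as constant here. -/
lemma expect_gradLaw_linear (θ : Params L d) (i j : Coord L d) (B : Matrix (Fin 2) (Fin 2) ℝ)
    (v : Fin 2 → ℝ) :
    expect (M.gradLaw θ i j) (fun g => v ⬝ᵥ (B *ᵥ ![g.1, g.2]))
      = v ⬝ᵥ (B *ᵥ ![gradient M.loss θ i, gradient M.loss θ j]) := by
  have h : ∀ a b : ℝ, v ⬝ᵥ (B *ᵥ ![a, b])
      = (v 0 * B 0 0 + v 1 * B 1 0) * a + (v 0 * B 0 1 + v 1 * B 1 1) * b := by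
    intro a b
    simp [mulVec, dotProduct, Fin.sum_univ_two]
    ring
  simp only [expect_gradLaw, h, expect_add, expect_const_mul, expect_const,
    expect_partialLaw_eq_gradient]

lemma sq_add_sq_mulVec_le (B : Matrix (Fin 2) (Fin 2) ℝ) (g : ℝ × ℝ) :
    (B *ᵥ ![g.1, g.2]) 0 ^ 2 + (B *ᵥ ![g.1, g.2]) 1 ^ 2
      ≤ ‖Matrix.toEuclideanCLM (𝕜 := ℝ) B‖ ^ 2 * ‖!₂[g.1, g.2]‖ ^ 2 := by
  have h := (Matrix.toEuclideanCLM (𝕜 := ℝ) B).le_opNorm !₂[g.1, g.2]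
  have h2 : ‖Matrix.toEuclideanCLM (𝕜 := ℝ) B !₂[g.1, g.2]‖ ^ 2
      = (B *ᵥ ![g.1, g.2]) 0 ^ 2 + (B *ᵥ ![g.1, g.2]) 1 ^ 2 := by
    rw [EuclideanSpace.norm_sq_eq, Fin.sum_univ_two]
    simp
  rw [← h2, ← mul_pow]
  gcongr

/-- The expected descent in one step, for a given pair of coordinates. -/
lemma expect_loss_update_le (hc : 2 < L * d) {L₂ β η : ℝ} (hL₂ : 0 < L₂) (hβ : 0 < β) (hη : 0 < η)
    {S : Set (Params L d)} (hsmooth : M.PairwiseSmooth L₂) (hreg : M.Regularizes hc S β)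
    (hbdd : BddAbove (M.momentSet hc S β)) {θ : Params L d} (hθ : θ ∈ S)
    {ij : Coord L d × Coord L d} (hij : ij ∈ (pairLaw hc).support) (x : Coord L d → ℝ) :
    expect (M.metricLaw θ ij.1 ij.2) (fun o => expect (M.gradLaw θ ij.1 ij.2) fun g =>
        M.loss (update β η ij.1 ij.2 o g θ))
      ≤ M.loss θ + (-(η / (numParams L d - 1))) *
          (2 * (x ij.1 * gradient M.loss θ ij.1 + x ij.2 * gradient M.loss θ ij.2)
            - M.pairForm β θ x ij.1 ij.2)
        + L₂ / 2 * (η / (numParams L d - 1)) ^ 2 * M.alphaSq hc S β := by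
  obtain ⟨hne, hle⟩ := mem_support_pairLaw hc hij
  have hc' := two_lt_numParams hc
  set τ := η / (numParams L d - 1) with hτ
  have hτ0 : 0 < τ := div_pos hη (by linarith)
  obtain ⟨i, j⟩ := ij
  simp only at hne hle ⊢
  set v : Fin 2 → ℝ := ![gradient M.loss θ i, gradient M.loss θ j] with hv
  -- Smoothness at the actual displacement. Positive definiteness gives `|A| = A`, so the operator
  -- norm in `momentProduct` controls the quadratic term.
  have hstep : ∀ o ∈ (M.metricLaw θ i j).support, ∀ g : ℝ × ℝ,
      M.loss (update β η i j o g θ) ≤ M.loss θ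
        + (-τ) * (v ⬝ᵥ ((zShifted L d β o)⁻¹ *ᵥ ![g.1, g.2]))
        + L₂ / 2 * τ ^ 2 * (‖Matrix.toEuclideanCLM (𝕜 := ℝ) (CFC.abs (zShifted L d β o))⁻¹‖ ^ 2
          * ‖!₂[g.1, g.2]‖ ^ 2) := by
    intro o ho g
    have hpos := hreg θ hθ (i, j) hij o ho
    rw [update_eq hc hβ η hne hpos, CFC.abs_of_nonneg _ hpos.posSemidef.nonneg]
    refine (hsmooth i j θ _ _).trans ?_
    rw [inner_pair, norm_sq_pair hne]
    have h1 := sq_add_sq_mulVec_le (zShifted L d β o)⁻¹ g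
    set w := (zShifted L d β o)⁻¹ *ᵥ ![g.1, g.2]
    have h2 : v ⬝ᵥ w = gradient M.loss θ i * w 0 + gradient M.loss θ j * w 1 := by
      simp [hv, dotProduct, Fin.sum_univ_two]
    have h3 := mul_le_mul_of_nonneg_left h1 (by positivity : 0 ≤ L₂ / 2 * τ ^ 2)
    rw [h2]
    linarith
  -- Averaging over `g` turns the first-order term into `v·A⁻¹v`; the variational bound at the fixed
  -- `x` makes it linear in `A`, so the mean of an inverse is never needed.
  have hmean : ∀ o ∈ (M.metricLaw θ i j).support,
      expect (M.gradLaw θ i j) (fun g => M.loss (update β η i j o g θ))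
        ≤ M.loss θ + (-τ) * (2 * (x i * gradient M.loss θ i + x j * gradient M.loss θ j)
            - ![x i, x j] ⬝ᵥ (zShifted L d β o *ᵥ ![x i, x j]))
          + L₂ / 2 * τ ^ 2 * (‖Matrix.toEuclideanCLM (𝕜 := ℝ) (CFC.abs (zShifted L d β o))⁻¹‖ ^ 2
          * expect (M.gradLaw θ i j) fun g => ‖!₂[g.1, g.2]‖ ^ 2) := by
    intro o ho
    refine (expect_mono _ _ _ fun g _ => hstep o ho g).trans ?_
    rw [expect_add, expect_add, expect_const, expect_const_mul, expect_const_mul, expect_const_mul,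
      expect_gradLaw_linear]
    have h1 := le_dotProduct_inv_mulVec (hreg θ hθ (i, j) hij o ho) v ![x i, x j]
    have h2 : ![x i, x j] ⬝ᵥ v = x i * gradient M.loss θ i + x j * gradient M.loss θ j := by
      simp [hv, dotProduct, Fin.sum_univ_two]
    rw [h2] at h1
    have h3 := mul_le_mul_of_nonneg_left h1 hτ0.le
    linarith
  refine (expect_mono _ _ _ hmean).trans ?_
  rw [expect_add, expect_add, expect_const, expect_const_mul, expect_sub, expect_const,
    expect_zShifted_form _ _ _ _ hle, expect_const_mul, expect_mul_const]
  have hα : M.momentProduct β θ i j ≤ M.alphaSq hc S β := le_csSup hbdd ⟨θ, hθ, (i, j), hij, rfl⟩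
  have := mul_le_mul_of_nonneg_left hα (by positivity : 0 ≤ L₂ / 2 * τ ^ 2)
  unfold momentProduct at this
  linarith

/-- The set of moment products is bounded: there are finitely many outcomes. -/
lemma bddAbove_momentSet (hc : 2 < L * d) (S : Set (Params L d)) (β : ℝ) :
    BddAbove (M.momentSet hc S β) := by
  -- The matrix depends on the outcome only, not on `θ` or the pair, so one constant serves all of
  -- `S`.
  obtain ⟨C₁, hC₁⟩ := (Set.finite_range fun o : MetricOutcome =>
    ‖Matrix.toEuclideanCLM (𝕜 := ℝ) (CFC.abs (zShifted L d β o))⁻¹‖ ^ 2).bddAbove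
  obtain ⟨C₂, hC₂⟩ := (Set.finite_range fun p : Y × Y => M.ℓ p.1 p.2 ^ 2).bddAbove
  have hg : ∀ (θ : Params L d) i, ∀ a ∈ (M.partialLaw θ i).support, a ^ 2 ≤ C₂ := by
    intro θ i a ha
    unfold partialLaw at ha
    rw [PMF.support_bind] at ha
    simp only [Set.mem_iUnion, PMF.support_map, Set.mem_image] at ha
    obtain ⟨s, _, o, _, rfl⟩ := ha
    rw [mul_pow, ← pow_mul, mul_comm _ 2, pow_mul]
    simpa using hC₂ ⟨(s.2, o.1), rfl⟩
  refine ⟨C₁ * (C₂ + C₂), ?_⟩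
  rintro m ⟨θ, hθ, ij, hij, rfl⟩
  refine mul_le_mul ?_ ?_ (expect_nonneg _ fun g _ => by positivity) ?_
  · exact (expect_mono _ _ _ fun o _ => hC₁ ⟨o, rfl⟩).trans (expect_const _ _).le
  · rw [expect_gradLaw]
    refine (expect_mono _ _ (fun _ => C₂ + C₂) fun a ha => ?_).trans (expect_const _ _).le
    refine (expect_mono _ _ (fun _ => C₂ + C₂) fun b hb => ?_).trans (expect_const _ _).le
    rw [EuclideanSpace.norm_sq_eq, Fin.sum_univ_two]
    simpa using add_le_add (hg θ _ a ha) (hg θ _ b hb)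
  · exact (sq_nonneg _).trans (hC₁ ⟨(1, 1, (1, 1), (1, 1)), rfl⟩)

lemma alphaSq_nonneg (hc : 2 < L * d) (S : Set (Params L d)) (β : ℝ) : 0 ≤ M.alphaSq hc S β := by
  refine Real.sSup_nonneg ?_
  rintro m ⟨θ, _, ij, _, rfl⟩
  exact mul_nonneg (expect_nonneg _ fun _ _ => by positivity)
    (expect_nonneg _ fun _ _ => by positivity)

/-- The natural gradient with respect to the regularized metric. -/
def natGrad (β : ℝ) (θ : Params L d) : Coord L d → ℝ :=
  (M.regMetric β θ)⁻¹ *ᵥ (gradient M.loss θ).ofLp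

/-- Invertibility is not required: for a singular matrix `⁻¹` is zero, and both sides vanish. -/
lemma natGrad_dotProduct_regMetric (β : ℝ) (θ : Params L d) :
    M.natGrad β θ ⬝ᵥ (M.regMetric β θ *ᵥ M.natGrad β θ)
      = M.natGrad β θ ⬝ᵥ (gradient M.loss θ).ofLp := by
  by_cases h : IsUnit (M.regMetric β θ).det
  · have : M.regMetric β θ *ᵥ M.natGrad β θ = (gradient M.loss θ).ofLp := by
      rw [natGrad, mulVec_mulVec, mul_nonsing_inv _ h, one_mulVec]
    rw [this]
  · have : M.natGrad β θ = 0 := by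
      rw [natGrad, nonsing_inv_apply_not_isUnit _ h, zero_mulVec]
    rw [this, zero_dotProduct, zero_dotProduct]

lemma expect_stepLaw (hc : 2 < L * d) (β η : ℝ) (θ : Params L d) (f : Params L d → ℝ) :
    expect (M.stepLaw hc β η θ) f = expect (pairLaw hc) fun ij =>
      expect (M.metricLaw θ ij.1 ij.2) fun o => expect (M.gradLaw θ ij.1 ij.2) fun g =>
        f (update β η ij.1 ij.2 o g θ) := by
  simp only [stepLaw, expect_bind, expect_pure]

instance (hc : 2 < L * d) (β η : ℝ) (θ : Params L d) : FiniteSupport (M.stepLaw hc β η θ) := by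
  unfold stepLaw; infer_instance

instance (hc : 2 < L * d) (β η : ℝ) (θ₀ : Params L d) (t : ℕ) :
    FiniteSupport (M.iterLaw hc β η θ₀ t) := ⟨M.iterLaw_support_finite hc β η θ₀ t⟩

variable {M}

/-- The expected descent in one step of the algorithm. -/
lemma expect_loss_step_le (hc : 2 < L * d) {L₂ β μ η : ℝ} (hL₂ : 0 < L₂) (hβ : 0 < β)
    (hη : 0 < η) {θstar : Params L d} {S : Set (Params L d)}
    (hsmooth : M.PairwiseSmooth L₂) (hQGI : M.RegularizedQGI S β μ θstar)
    (hreg : M.Regularizes hc S β) {θ : Params L d} (hθ : θ ∈ S) :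
    expect (M.stepLaw hc β η θ) (fun θ' => M.loss θ' - M.loss θstar)
      ≤ (1 - 4 * μ * η / (numParams L d * (numParams L d - 1))) * (M.loss θ - M.loss θstar)
        + L₂ / 2 * (η / (numParams L d - 1)) ^ 2 * M.alphaSq hc S β := by
  have hc' := two_lt_numParams hc
  have hc1 : 0 < numParams L d - 1 := by linarith
  have hc0 : 0 < numParams L d := by linarith
  -- This `x` is independent of the random outcomes, as the variational bound requires, and turns
  -- `2x·v - x·Gx` into `x·v`.
  set x := M.natGrad β θ with hx
  set v := (gradient M.loss θ).ofLp with hv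
  set τ := η / (numParams L d - 1) with hτ
  have hτ0 : 0 < τ := div_pos hη hc1
  have h1 : expect (M.stepLaw hc β η θ) (fun θ' => M.loss θ') ≤
      M.loss θ + (-τ) * (2 / numParams L d * (x ⬝ᵥ v)) + L₂ / 2 * τ ^ 2 * M.alphaSq hc S β := by
    rw [expect_stepLaw]
    refine (expect_mono _ _ _ fun ij hij => M.expect_loss_update_le hc hL₂ hβ hη hsmooth hreg
      (M.bddAbove_momentSet hc S β) hθ hij x).trans ?_
    rw [expect_add, expect_add, expect_const, expect_const, expect_const_mul, expect_sub,
      expect_const_mul, expect_pairLaw_add hc fun i => x i * gradient M.loss θ i, expect_pairForm,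
      M.natGrad_dotProduct_regMetric]
    have h2 : ∑ i, x i * gradient M.loss θ i = x ⬝ᵥ v := rfl
    rw [h2, ← hx, ← hv]
    have h3 : 0 ≤ x ⬝ᵥ x := by
      simpa [dotProduct] using Finset.sum_nonneg fun i _ => mul_self_nonneg (x i)
    -- The gain from `β(1 + 2/c)|x|²` has the favourable sign and is discarded.
    have h4 : 0 ≤ τ * (2 / numParams L d * (β * (1 + 2 / numParams L d) * (x ⬝ᵥ x))) := by
      positivity
    linarith
  have h5 := hQGI θ hθ
  change μ * (M.loss θ - M.loss θstar) ≤ 1 / 2 * (v ⬝ᵥ x) at h5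
  rw [dotProduct_comm] at h5
  rw [expect_sub, expect_const]
  have h6 := mul_le_mul_of_nonneg_left h5 (by positivity : 0 ≤ 4 * τ / numParams L d)
  have h7 : 4 * τ / numParams L d * (1 / 2 * (x ⬝ᵥ v)) = τ * (2 / numParams L d * (x ⬝ᵥ v)) := by
    ring
  have h8 : 4 * τ / numParams L d * (μ * (M.loss θ - M.loss θstar))
      = 4 * μ * η / (numParams L d * (numParams L d - 1)) * (M.loss θ - M.loss θstar) := by
    rw [hτ]; field_simp
  linarith

/-! ### An upper bound for the QGI constant -/

/-- Smoothness bounds the gradient by the optimality gap. -/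
lemma gradient_dotProduct_le (hc : 2 < L * d) {L₂ : ℝ} (hL₂ : 0 < L₂) {θstar : Params L d}
    (hmin : ∀ θ, M.loss θstar ≤ M.loss θ) (hsmooth : M.PairwiseSmooth L₂) (θ : Params L d) :
    (gradient M.loss θ).ofLp ⬝ᵥ (gradient M.loss θ).ofLp
      ≤ numParams L d * L₂ * (M.loss θ - M.loss θstar) := by
  have hc' := two_lt_numParams hc
  have hc0 : 0 < numParams L d := by linarith
  have h : expect (pairLaw hc) (fun ij => gradient M.loss θ ij.1 ^ 2 + gradient M.loss θ ij.2 ^ 2)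
      ≤ 2 * L₂ * (M.loss θ - M.loss θstar) := by
    refine (expect_mono _ _ (fun _ => 2 * L₂ * (M.loss θ - M.loss θstar)) fun ij hij => ?_).trans
      (expect_const _ _).le
    have hne := (mem_support_pairLaw hc hij).1
    set a := gradient M.loss θ ij.1
    set b := gradient M.loss θ ij.2
    -- The step of length `1/L₂` against the partial derivatives minimizes the smoothness bound, and
    -- even there the loss is at least its minimum.
    have h1 := (hmin _).trans (hsmooth ij.1 ij.2 θ (-(a / L₂)) (-(b / L₂)))
    rw [inner_pair, norm_sq_pair hne] at h1
    have h2 : -(a / L₂) * a + -(b / L₂) * b + L₂ / 2 * ((-(a / L₂)) ^ 2 + (-(b / L₂)) ^ 2)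
        = -((a ^ 2 + b ^ 2) / (2 * L₂)) := by
      field_simp; ring
    have h3 : (a ^ 2 + b ^ 2) / (2 * L₂) ≤ M.loss θ - M.loss θstar := by linarith
    rw [div_le_iff₀ (by positivity)] at h3
    linarith
  rw [expect_pairLaw_add hc fun i => gradient M.loss θ i ^ 2] at h
  have h4 : (gradient M.loss θ).ofLp ⬝ᵥ (gradient M.loss θ).ofLp
      = ∑ i, gradient M.loss θ i ^ 2 := by simp [dotProduct, sq]
  rw [h4]
  rw [div_mul_eq_mul_div, div_le_iff₀ hc0] at h
  linarith

/-- If some point of `S` is not optimal, then the QGI constant is at most the smoothness. -/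
lemma qgi_constant_le (hc : 2 < L * d) {L₂ β μ : ℝ} (hL₂ : 0 < L₂) (hβ : 0 < β)
    {θstar : Params L d} (hmin : ∀ θ, M.loss θstar ≤ M.loss θ) {S : Set (Params L d)}
    (hsmooth : M.PairwiseSmooth L₂) (hQGI : M.RegularizedQGI S β μ θstar)
    (hreg : M.Regularizes hc S β) {θ : Params L d} (hθ : θ ∈ S)
    (hgap : M.loss θstar < M.loss θ) :
    2 * μ * β * (numParams L d + 2) ≤ numParams L d ^ 2 * L₂ := by
  have hc' := two_lt_numParams hc
  have hc0 : 0 < numParams L d := by linarith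
  set x := M.natGrad β θ with hx
  set v := (gradient M.loss θ).ofLp with hv
  set κ := β * (1 + 2 / numParams L d) with hκ
  have hκ0 : 0 < κ := by positivity
  -- The form is a mean of forms of positive definite matrices. By `expect_pairForm` this yields
  -- `κ|x|² ≤ x·Gx = x·v`.
  have hform : 0 ≤ expect (pairLaw hc) (fun ij => M.pairForm β θ x ij.1 ij.2) := by
    refine expect_nonneg _ fun ij hij => ?_
    rw [← M.expect_zShifted_form β θ x (mem_support_pairLaw hc hij).2]
    refine expect_nonneg _ fun o ho => ?_
    simpa using (hreg θ hθ ij hij o ho).posSemidef.dotProduct_mulVec_nonneg ![x ij.1, x ij.2]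
  rw [expect_pairForm, M.natGrad_dotProduct_regMetric, ← hx, ← hv, ← hκ] at hform
  have h1 : κ * (x ⬝ᵥ x) ≤ x ⬝ᵥ v := by
    have := nonneg_of_mul_nonneg_right hform (by positivity)
    linarith
  -- Expanding this square and using `κ|x|² ≤ x·v` gives `κ x·v ≤ |v|²`.
  have h2 : 0 ≤ (κ • x - v) ⬝ᵥ (κ • x - v) := by
    simpa [dotProduct] using Finset.sum_nonneg fun i _ => mul_self_nonneg ((κ • x - v) i)
  have h3 : (κ • x - v) ⬝ᵥ (κ • x - v) = κ * (κ * (x ⬝ᵥ x)) - 2 * (κ * (x ⬝ᵥ v)) + v ⬝ᵥ v := by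
    simp only [sub_dotProduct, dotProduct_sub, smul_dotProduct, dotProduct_smul, smul_eq_mul,
      dotProduct_comm v x]
    ring
  have h4 : κ * (x ⬝ᵥ v) ≤ v ⬝ᵥ v := by
    have := mul_le_mul_of_nonneg_left h1 hκ0.le
    linarith
  have h5 := hQGI θ hθ
  change μ * (M.loss θ - M.loss θstar) ≤ 1 / 2 * (v ⬝ᵥ x) at h5
  rw [dotProduct_comm] at h5
  have h6 := gradient_dotProduct_le hc hL₂ hmin hsmooth θ
  have h7 := mul_le_mul_of_nonneg_left h5 (by positivity : 0 ≤ 2 * κ)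
  -- The chain is `2κμ·gap ≤ κ x·v ≤ |v|² ≤ c L₂·gap`; the gap is positive and cancels.
  have h8 : 2 * κ * μ * (M.loss θ - M.loss θstar)
      ≤ numParams L d * L₂ * (M.loss θ - M.loss θstar) := by linarith
  have h9 := le_of_mul_le_mul_right h8 (sub_pos.2 hgap)
  have h10 := mul_le_mul_of_nonneg_left h9 hc0.le
  have h11 : numParams L d * (2 * κ * μ) = 2 * μ * β * (numParams L d + 2) := by
    rw [hκ]; field_simp
  linarith

end Model

/-! ### The recursion and its limit -/

/-- A sequence with `a (t + 1) ≤ (1 - r) a t + e` decays geometrically up to an error `E ≥ e / r`. -/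
lemma le_geometric_add {a : ℕ → ℝ} {r e E : ℝ} (hr1 : r ≤ 1) (he : e ≤ r * E)
    (h0 : 0 ≤ E) (h : ∀ t, a (t + 1) ≤ (1 - r) * a t + e) (t : ℕ) :
    a t ≤ (1 - r) ^ t * a 0 + E := by
  induction t with
  | zero => simpa using h0
  | succ t ih =>
    -- Once `1 - r` is nonnegative, the error level is preserved because `(1 - r) E + e ≤ E`.
    have := mul_le_mul_of_nonneg_left ih (sub_nonneg.2 hr1)
    rw [pow_succ]
    linarith [h t]

end QNSCD
end

theorem theorem3 {L d : ℕ} {X Y : Type*} [Fintype X] [Fintype Y] (M : QNSCD.Model L d X Y)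
    (hc : 2 < L * d)
    (L₂ β μ : ℝ) (hL₂ : 0 < L₂) (hβ : 0 < β) (hμ : 0 < μ)
    (θ₀ θstar : QNSCD.Params L d) (hmin : ∀ θ, M.loss θstar ≤ M.loss θ)
    (S : Set (QNSCD.Params L d))
    (hS : ∀ t, (M.iterLaw hc β (β / L₂) θ₀ t).support ⊆ S)
    (hsmooth : M.PairwiseSmooth L₂)
    (hQGI : M.RegularizedQGI S β μ θstar)
    (hreg : M.Regularizes hc S β) :
    BddAbove (M.momentSet hc S β) ∧
    (∀ t : ℕ,
      QNSCD.expect (M.iterLaw hc β (β / L₂) θ₀ t) (fun θ => M.loss θ - M.loss θstar)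
        ≤ (1 - 4 * μ * β / (QNSCD.numParams L d ^ 2 * L₂)) ^ t * (M.loss θ₀ - M.loss θstar)
          + M.alphaSq hc S β * β / (4 * μ)) ∧
    Filter.limsup (fun t : ℕ =>
        QNSCD.expect (M.iterLaw hc β (β / L₂) θ₀ t) (fun θ => M.loss θ - M.loss θstar))
      Filter.atTop
      ≤ M.alphaSq hc S β * β / (4 * μ) := by
  have hc' := QNSCD.two_lt_numParams hc
  have hα := M.alphaSq_nonneg hc S β
  set c := QNSCD.numParams L d with hcdef
  have hc0 : 0 < c := by linarith
  have hc1 : 0 < c - 1 := by linarith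
  set E := M.alphaSq hc S β * β / (4 * μ) with hE
  have hE0 : 0 ≤ E := by positivity
  set a : ℕ → ℝ := fun t =>
    QNSCD.expect (M.iterLaw hc β (β / L₂) θ₀ t) (fun θ => M.loss θ - M.loss θstar) with ha
  have ha0 : a 0 = M.loss θ₀ - M.loss θstar := by
    simp only [ha, QNSCD.Model.iterLaw, QNSCD.expect_pure]
  have hanonneg : ∀ t, 0 ≤ a t := fun t =>
    QNSCD.expect_nonneg _ fun θ _ => sub_nonneg.2 (hmin θ)
  refine ⟨M.bddAbove_momentSet hc S β, ?_⟩
  -- The bound `r ≤ 1` is extracted from a nonoptimal point of `S`. Without one, the iterates are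
  -- optimal and the geometric term is multiplied by zero, whatever the sign of its base.
  by_cases hopt : ∀ θ ∈ S, M.loss θ = M.loss θstar
  · have hzero : ∀ t, a t = 0 := fun t =>
      (QNSCD.expect_congr _ fun θ hθ => sub_eq_zero.2 (hopt θ (hS t hθ))).trans
        (QNSCD.expect_const _ 0)
    have h0 : M.loss θ₀ - M.loss θstar = 0 := by rw [← ha0, hzero]
    refine ⟨fun t => ?_, ?_⟩
    · change a t ≤ _
      rw [hzero, h0, mul_zero, zero_add]
      exact hE0
    · have : a = fun _ => 0 := funext hzero
      rw [this, Filter.limsup_const]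
      exact hE0
  · push Not at hopt
    obtain ⟨θ₁, hθ₁, hne⟩ := hopt
    have hμle := QNSCD.Model.qgi_constant_le hc hL₂ hβ hmin hsmooth hQGI hreg hθ₁
      (lt_of_le_of_ne (hmin θ₁) hne.symm)
    rw [← hcdef] at hμle
    set r := 4 * μ * (β / L₂) / (c * (c - 1)) with hr
    set r' := 4 * μ * β / (c ^ 2 * L₂) with hr'
    have hr0 : 0 < r := by positivity
    have hr'0 : 0 < r' := by positivity
    have hrr' : r' ≤ r := by
      have : r = 4 * μ * β / (c * (c - 1) * L₂) := by rw [hr]; field_simp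
      rw [this, hr']
      refine div_le_div_of_nonneg_left (by positivity) (by positivity) ?_
      nlinarith
    -- After multiplication by `c + 2`, `qgi_constant_le` reduces the claim to `2c ≤ (c-1)(c+2)`,
    -- that is, `(c-2)(c+1) ≥ 0`.
    have hr1 : r ≤ 1 := by
      have : r = 4 * μ * β / (c * (c - 1) * L₂) := by rw [hr]; field_simp
      rw [this, div_le_one (by positivity)]
      refine le_of_mul_le_mul_right ?_ (by linarith : 0 < c + 2)
      have h1 : 2 * c ≤ (c - 1) * (c + 2) := by nlinarith
      have h2 := mul_le_mul_of_nonneg_left h1 (by positivity : 0 ≤ c * L₂)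
      linarith
    have hr'1 : r' < 1 := by
      rw [hr', div_lt_one (by positivity)]
      have : 0 < μ * β * (c - 2) := mul_pos (mul_pos hμ hβ) (by linarith)
      nlinarith [mul_pos hμ hβ]
    have hstep : ∀ t, a (t + 1) ≤ (1 - r) * a t
        + L₂ / 2 * (β / L₂ / (c - 1)) ^ 2 * M.alphaSq hc S β := by
      intro t
      have h1 : a (t + 1) = QNSCD.expect (M.iterLaw hc β (β / L₂) θ₀ t) fun θ =>
          QNSCD.expect (M.stepLaw hc β (β / L₂) θ) fun θ' => M.loss θ' - M.loss θstar := by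
        simp only [ha, QNSCD.Model.iterLaw, QNSCD.expect_bind]
      rw [h1]
      refine (QNSCD.expect_mono _ _ _ fun θ hθ => QNSCD.Model.expect_loss_step_le hc hL₂ hβ
        (div_pos hβ hL₂) hsmooth hQGI hreg (hS t hθ)).trans ?_
      rw [QNSCD.expect_add, QNSCD.expect_const_mul, QNSCD.expect_const]
    -- After cancellation this is `1/(2(c-1)) ≤ 1/c`, which holds since `c ≥ 2`.
    have herr : L₂ / 2 * (β / L₂ / (c - 1)) ^ 2 * M.alphaSq hc S β ≤ r * E := by
      have h1 : L₂ / 2 * (β / L₂ / (c - 1)) ^ 2 * M.alphaSq hc S β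
          = M.alphaSq hc S β * β ^ 2 / (L₂ * (c - 1)) * (1 / (2 * (c - 1))) := by
        field_simp
      have h2 : r * E = M.alphaSq hc S β * β ^ 2 / (L₂ * (c - 1)) * (1 / c) := by
        rw [hr, hE]; field_simp
      rw [h1, h2]
      refine mul_le_mul_of_nonneg_left ?_ (by positivity)
      exact one_div_le_one_div_of_le hc0 (by linarith)
    have hbound : ∀ t, a t ≤ (1 - r') ^ t * (M.loss θ₀ - M.loss θstar) + E := by
      intro t
      refine (QNSCD.le_geometric_add hr1 herr hE0 hstep t).trans ?_
      rw [ha0]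
      have h0 : 0 ≤ M.loss θ₀ - M.loss θstar := sub_nonneg.2 (hmin θ₀)
      -- The recursion contracts at the faster rate `r`; the stated rate `r'` has `c²` in place of
      -- `c(c-1)`.
      have := pow_le_pow_left₀ (sub_nonneg.2 hr1) (sub_le_sub_left hrr' 1) t
      gcongr
    refine ⟨hbound, ?_⟩
    have hlim : Filter.Tendsto (fun t : ℕ => (1 - r') ^ t * (M.loss θ₀ - M.loss θstar) + E)
        Filter.atTop (nhds E) := by
      have := ((tendsto_pow_atTop_nhds_zero_of_lt_one (r := 1 - r') (by linarith)
        (by linarith)).mul_const (M.loss θ₀ - M.loss θstar)).add_const E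
      simpa using this
    rw [← hlim.limsup_eq]
    -- Comparing real limits superior needs boundedness: the gaps are nonnegative, and the majorant
    -- converges.
    exact Filter.limsup_le_limsup (Filter.Eventually.of_forall hbound)
      (Filter.isCoboundedUnder_le_of_le Filter.atTop hanonneg)
      hlim.isBoundedUnder_le
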